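/- **Theorem 3.6.** Let $D$ be a diagram of an unoriented framed link, and let $G = G_{s_+}(D)$ be the graph (loops and multiple edges allowed) whose vertices are the circles of the system $D_{s_+}$ obtained by smoothing every crossing of $D$ according to the positive marker, and whose edges are the crossings of $D$, each edge joining the circle(s) that meet at that crossing. Let $V$ and $E$ be the numbers of vertices and edges of $G$, and let $\ell$ be the girth of $G$, i.e. the length of a shortest cycle (a loop has length $1$, two parallel edges form a cycle of length $2$, and $\ell=\infty$ if $G$ is a forest). For integers $i\ge 0$ and $j$ put $$a = E-2i,\qquad b = E-2V+4j .$$ (i) If $i<\ell-1$, then $H^{i,j}_{\mathcal A_2}(G)\cong H_{a,b}(D)$. (ii) If $i=\ell-1$, then $\operatorname{tor} H^{i,j}_{\mathcal A_2}(G)\cong \operatorname{tor} H_{a,b}(D)$, where $\operatorname{tor}$ denotes the torsion subgroup. Here $H^{i,j}_{\mathcal A_2}(G)$ is the chromatic graph cohomology of $G$ with the algebra $\mathcal A_2=\mathbb Z[x]/(x^2)$, $\deg x=1$: it is the cohomology of the complex $C^i(G)=\bigoplus_{s\subset E(G),\,|s|=i}\mathcal A_2^{\otimes k(s)}$, with one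 tensor factor for each of the $k(s)$ components of the spanning subgraph $[G:s]$ with edge set $s$, graded by the total degree $j$. The differential on the summand of $s$ is $\sum_{e\notin s}(-1)^{t(s,e)}d_e$, where $t(s,e)$ is the number of edges of $s$ preceding $e$ in a fixed ordering of the edges, and $d_e$ multiplies the two tensor factors if $e$ joins two components of $[G:s]$ and is the identity if both ends of $e$ are in the same component. $H_{a,b}(D)$ is the Khovanov homology of the framed unoriented link given by $D$: $C_{a,b}(D)$ is the free abelian group on the enhanced Kauffman states $S$ (a marker $\pm1$ at each crossing, and a sign $\pm1$ on each circle of the smoothed diagram) with $\sigma(S)=a$ and $\sigma(S)+2\tau(S)=b$, where $\sigma(S)$ is the sum of the markers and $\tau(S)$ the sum of the signs of the circles. The boundary map $C_{a,b}(D)\to C_{a-2,b}(D)$ sends $S$ to $\sum\pm S'$ over those $S'$ that are obtained by changing one positive marker to a negative one, keeping the signs of the circles that do not meet this crossing, and such that $\tau(S')=\tau(S)+1$; the sign is $(-1)^t$, where $t$ is the number of negative markers of $S$ at the crossings preceding the changed one in a fixed ordering of the crossings. -/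

import Mathlib

/-! ## Homology of a pair of consecutive maps -/

/-- The homology `ker g / im f` at the middle term of `A → B → C`. -/
abbrev HomologyAt {A B C : Type*} [AddCommGroup A] [AddCommGroup B] [AddCommGroup C]
    (f : A →ₗ[ℤ] B) (g : B →ₗ[ℤ] C) : Type _ :=
  LinearMap.ker g ⧸ (LinearMap.range f).submoduleOf (LinearMap.ker g)

/-! ## Chromatic graph cohomology over `ℤ[x]/(x^m)`

Graphs are finite multigraphs: loops and multiple edges are allowed. -/

namespace Graph

/-- `G` contains a cycle of length `n + 1`: cyclically ordered distinct vertices, consecutive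
ones joined by distinct edges. A loop is a cycle of length `1`, and two parallel edges form a cycle
of length `2`. -/
def HasCycleOfLengthSucc {α β : Type*} (G : Graph α β) (n : ℕ) : Prop :=
  ∃ (v : Fin (n + 1) → α) (e : Fin (n + 1) → β), Function.Injective v ∧ Function.Injective e ∧
    ∀ k, G.IsLink (e k) (v k) (v (k + 1))

/-- The length of a shortest cycle; it is `⊤` for a forest. -/
noncomputable def girth {α β : Type*} (G : Graph α β) : ℕ∞ :=
  ⨅ (n : ℕ) (_ : G.HasCycleOfLengthSucc n), ((n : ℕ∞) + 1)

/-- The connected components of the subgraph `[G : s]` of `G` that contains all the vertices of `G`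
and the edges in `s`. -/
def StateComponent {α β : Type*} (G : Graph α β) (s : Finset β) : Type _ :=
  Quot fun u v : G.vertexSet => (G.restrict (s : Set β)).Adj u v

/-- The component of `[G : s]` that contains the vertex `v`. -/
def stateComponent {α β : Type*} (G : Graph α β) (s : Finset β) (v : G.vertexSet) :
    G.StateComponent s :=
  Quot.mk _ v

instance {α β : Type*} [Finite α] (G : Graph α β) (s : Finset β) : Finite (G.StateComponent s) :=
  Finite.of_surjective (G.stateComponent s) Quot.mk_surjective

noncomputable instance {α β : Type*} [Finite α] (G : Graph α β) (s : Finset β) :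
    Fintype (G.StateComponent s) :=
  Fintype.ofFinite _

/-- An enhanced state of `G` for the algebra `ℤ[x]/(x^m)`: a set `s` of edges of `G`, every
component `c` of `[G : s]` being decorated by the basis element `x ^ (weight c)` of `ℤ[x]/(x^m)`.
The enhanced states with a given `s` are the monomial basis of the tensor product
of copies of `ℤ[x]/(x^m)`, one for each component of `[G : s]`. -/
structure EnhancedState {α β : Type*} (G : Graph α β) (m : ℕ) where
  edges : Finset β
  edges_subset : (edges : Set β) ⊆ G.edgeSet
  weight : G.StateComponent edges → Fin m

instance {α β : Type*} [Finite α] [Finite β] (G : Graph α β) (m : ℕ) :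
    Finite (G.EnhancedState m) :=
  Finite.of_injective
    (fun S => (⟨S.edges, S.weight⟩ : Σ s : Finset β, (G.StateComponent s → Fin m)))
    (by rintro ⟨s, hs, w⟩ ⟨s', hs', w'⟩ h; cases h; rfl)

/-- The degree of an enhanced state, where `x` has degree `1`. -/
noncomputable def EnhancedState.degree {α β : Type*} [Finite α] {G : Graph α β} {m : ℕ}
    (S : G.EnhancedState m) : ℕ :=
  ∑ c, (S.weight c : ℕ)

/-- The enhanced states that form the standard basis of the cochain group `C^{i,j}(G)`. -/
def BasisState {α β : Type*} [Finite α] (G : Graph α β) (m : ℕ) (i j : ℤ) : Type _ :=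
  {S : G.EnhancedState m // (S.edges.card : ℤ) = i ∧ (S.degree : ℤ) = j}

instance {α β : Type*} [Finite α] [Finite β] (G : Graph α β) (m : ℕ) (i j : ℤ) :
    Finite (G.BasisState m i j) :=
  inferInstanceAs (Finite (Subtype _))

noncomputable instance {α β : Type*} [Finite α] [Finite β] (G : Graph α β) (m : ℕ) (i j : ℤ) :
    Fintype (G.BasisState m i j) :=
  Fintype.ofFinite _

open Classical in
/-- `S'` is the image of `S` under the map `d_e`, where `e` is not in the state `s` of `S`:
the state of `S'` is `s ∪ {e}`, and the monomial on a component `c'` of `[G : s ∪ {e}]` is the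
product of the monomials on the components of `[G : s]` inside `c'`. So `d_e` multiplies the two
factors if `e` joins different components (giving `0`, that is no `S'`, if the exponents add up to
at least `m`), and it is the identity if both ends of `e` are in the same component. -/
def EnhancedState.IsImage {α β : Type*} [Finite α] [DecidableEq β] {G : Graph α β} {m : ℕ}
    (e : β) (S S' : G.EnhancedState m) : Prop :=
  e ∉ S.edges ∧ S'.edges = insert e S.edges ∧
    ∀ c' : G.StateComponent S'.edges, (S'.weight c' : ℕ) =
      ∑ c : G.StateComponent S.edges with
        ∃ v, G.stateComponent S.edges v = c ∧ G.stateComponent S'.edges v = c', (S.weight c : ℕ)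

open Classical in
/-- The coefficient of `S'` in `d(S) = ∑_{e ∉ s} (-1)^{t(s,e)} d_e(S)`, where `t(s,e)` is the number
of edges in `s` that precede `e` in the chosen ordering of the edges. -/
noncomputable def EnhancedState.incidence {α β : Type*} [Finite α] [Fintype β] [LinearOrder β]
    {G : Graph α β} {m : ℕ} (S S' : G.EnhancedState m) : ℤ :=
  ∑ e : β, if EnhancedState.IsImage e S S' then (-1) ^ (S.edges.filter (· < e)).card else 0

/-- The component `C^{i,j}(G) → C^{i',j}(G)` of the differential; it is zero unless `i' = i + 1`.
Here `C^{i,j}(G)` is the free abelian group on the basis states of bidegree `(i,j)`. -/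
noncomputable def chromaticD {α β : Type*} [Finite α] [Fintype β] [LinearOrder β] (G : Graph α β)
    (m : ℕ) (i i' j : ℤ) : (G.BasisState m i j → ℤ) →ₗ[ℤ] (G.BasisState m i' j → ℤ) :=
  (Matrix.of fun (S' : G.BasisState m i' j) (S : G.BasisState m i j) =>
    S.1.incidence S'.1).mulVecLin

/-- The chromatic graph cohomology `H^{i,j}(G)` over the algebra `ℤ[x]/(x^m)`. -/
abbrev ChromaticCohomology {α β : Type*} [Finite α] [Fintype β] [LinearOrder β] (G : Graph α β)
    (m : ℕ) (i j : ℤ) : Type _ :=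
  HomologyAt (G.chromaticD m (i - 1) i j) (G.chromaticD m i (i + 1) j)

end Graph

/-! ## Link diagrams and Khovanov homology -/

/-- The rotation by one step counterclockwise of the four ends at each of `n` crossings. -/
def endRotation (n : ℕ) : Equiv.Perm (Fin n × Fin 4) :=
  Equiv.prodCongr (Equiv.refl _) (Equiv.addRight 1)

/-- A diagram of an unoriented link (framed by the blackboard framing), given as a planar diagram
code. At every crossing `c` the four ends of the two crossing strands are `(c, 0)`, `(c, 1)`,
`(c, 2)`, `(c, 3)` in counterclockwise order; the lower strand is the one from `(c, 0)` to `(c, 2)`,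
and the upper one is the one from `(c, 1)` to `(c, 3)`. The involution `glue` says which ends are
joined by the arcs of the diagram. Besides there may be simple closed curves without crossings.

The code comes from a diagram on the plane if and only if the Euler characteristic `v - e + f`
of its underlying 4-valent ribbon graph is twice the number of its connected components. There are
`v = n` crossings and `e = 2 * n` arcs; the faces are the orbits of `endRotation * glue`. -/
structure LinkDiagram where
  numCrossings : ℕ
  glue : Equiv.Perm (Fin numCrossings × Fin 4)
  glue_glue : ∀ d, glue (glue d) = d
  glue_ne : ∀ d, glue d ≠ d
  numFreeCircles : ℕ
  planar :
    (numCrossings : ℤ) - 2 * numCrossings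
        + Nat.card (Quot fun d d' => d' = endRotation numCrossings (glue d))
      = 2 * Nat.card (Quot fun d d' => d' = endRotation numCrossings d ∨ d' = glue d)

namespace LinkDiagram

/-- The ends of the arcs at the crossings of a diagram. -/
abbrev End (D : LinkDiagram) : Type := Fin D.numCrossings × Fin 4

/-- A Kauffman state: a marker `1` or `-1` at every crossing. -/
abbrev KauffmanState (D : LinkDiagram) : Type := Fin D.numCrossings → ℤˣ

/-- The smoothing of a crossing according to its marker. The positive marker is in the two regions
swept by the upper strand `1`–`3` when it rotates counterclockwise, that is, in those between the
ends `1`, `2` and between the ends `3`, `0`. The positive smoothing merges these two regions, so it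
joins the end `0` with `1`, and `2` with `3`. The negative one joins `0` with `3`, and `1`
with `2`. -/
def smooth (D : LinkDiagram) (s : D.KauffmanState) (d : D.End) : D.End :=
  (d.1, if s d.1 = 1 then ![1, 0, 3, 2] d.2 else ![3, 2, 1, 0] d.2)

/-- The circles of the system `D_s` obtained by smoothing all the crossings of `D` according to the
state `s`. -/
def Circle (D : LinkDiagram) (s : D.KauffmanState) : Type :=
  (Quot fun d d' : D.End => d' = D.glue d ∨ d' = D.smooth s d) ⊕ Fin D.numFreeCircles

/-- The circle of `D_s` that passes through an end `d`. -/
def circleOf (D : LinkDiagram) (s : D.KauffmanState) (d : D.End) : D.Circle s :=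
  Sum.inl (Quot.mk _ d)

/-- The circles of `D_s` that are crossingless components of `D`. -/
def freeCircle (D : LinkDiagram) (s : D.KauffmanState) (f : Fin D.numFreeCircles) : D.Circle s :=
  Sum.inr f

instance (D : LinkDiagram) (s : D.KauffmanState) : Finite (D.Circle s) :=
  haveI : Finite (Quot fun d d' : D.End => d' = D.glue d ∨ d' = D.smooth s d) :=
    Finite.of_surjective _ Quot.mk_surjective
  inferInstanceAs (Finite (_ ⊕ _))

noncomputable instance (D : LinkDiagram) (s : D.KauffmanState) : Fintype (D.Circle s) :=
  Fintype.ofFinite _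

/-- The graph `G_s(D)` of a Kauffman state: its vertices are the circles of `D_s`, its edges are the
crossings of `D`, and the edge `c` joins the circle or circles of `D_s` that meet at `c`. -/
def stateGraph (D : LinkDiagram) (s : D.KauffmanState) :
    Graph (D.Circle s) (Fin D.numCrossings) where
  vertexSet := Set.univ
  edgeSet := Set.univ
  IsLink c x y := s(x, y) = s(D.circleOf s (c, 0), D.circleOf s (c, 2))
  isLink_symm _ _ := ⟨fun _ _ h => Sym2.eq_swap.trans h⟩
  eq_or_eq_of_isLink_of_isLink c x y v w h h' := by
    have hxy := h.trans h'.symm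
    rw [Sym2.eq_iff] at hxy
    tauto
  edge_mem_iff_exists_isLink c := ⟨fun _ => ⟨_, _, rfl⟩, fun _ => Set.mem_univ _⟩
  left_mem_of_isLink _ _ _ _ := Set.mem_univ _

/-- The state `s₊` with all markers positive. -/
def positiveState (D : LinkDiagram) : D.KauffmanState := fun _ => 1

/-- The graph `G_{s₊}(D)`. -/
abbrev positiveGraph (D : LinkDiagram) : Graph (D.Circle D.positiveState) (Fin D.numCrossings) :=
  D.stateGraph D.positiveState

/-- An enhanced Kauffman state: a Kauffman state `s` and a sign on every circle of `D_s`. -/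
structure EnhancedState (D : LinkDiagram) where
  marker : D.KauffmanState
  sign : D.Circle marker → ℤˣ

instance (D : LinkDiagram) : Finite D.EnhancedState :=
  Finite.of_injective
    (fun S => (⟨S.marker, S.sign⟩ : Σ s : D.KauffmanState, (D.Circle s → ℤˣ)))
    (by rintro ⟨s, w⟩ ⟨s', w'⟩ h; cases h; rfl)

/-- `σ(S)`: the number of positive markers minus the number of negative markers. -/
def EnhancedState.sigma {D : LinkDiagram} (S : D.EnhancedState) : ℤ := ∑ c, (S.marker c : ℤ)

/-- `τ(S)`: the number of positive circles minus the number of negative circles. -/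
noncomputable def EnhancedState.tau {D : LinkDiagram} (S : D.EnhancedState) : ℤ :=
  ∑ C, (S.sign C : ℤ)

/-- The enhanced Kauffman states that form the standard basis of the chain group `C_{a,b}(D)`. -/
def BasisState (D : LinkDiagram) (a b : ℤ) : Type :=
  {S : D.EnhancedState // S.sigma = a ∧ S.sigma + 2 * S.tau = b}

instance (D : LinkDiagram) (a b : ℤ) : Finite (D.BasisState a b) :=
  inferInstanceAs (Finite (Subtype _))

noncomputable instance (D : LinkDiagram) (a b : ℤ) : Fintype (D.BasisState a b) :=
  Fintype.ofFinite _

/-- `S'` is incident to `S` at the crossing `c`: the markers of `S` and `S'` differ only at `c`,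
where that of `S` is positive and that of `S'` is negative; the circles that do not pass through `c`,
which are common to both states, have the same signs in both; and `τ(S') = τ(S) + 1`. -/
def EnhancedState.IsIncident {D : LinkDiagram} (c : Fin D.numCrossings)
    (S S' : D.EnhancedState) : Prop :=
  S.marker c = 1 ∧ S'.marker = Function.update S.marker c (-1) ∧
    (∀ d : D.End, (∀ k, D.circleOf S.marker d ≠ D.circleOf S.marker (c, k)) →
      S'.sign (D.circleOf S'.marker d) = S.sign (D.circleOf S.marker d)) ∧
    (∀ f, S'.sign (D.freeCircle S'.marker f) = S.sign (D.freeCircle S.marker f)) ∧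
    S'.tau = S.tau + 1

open Classical in
/-- The coefficient of `S'` in the boundary of `S`: it is `(-1)^t` if `S'` is incident to `S` at a
crossing `c`, where `t` is the number of negative markers of `S` at the crossings that precede `c`
in the chosen ordering of the crossings. -/
noncomputable def EnhancedState.incidence {D : LinkDiagram} (S S' : D.EnhancedState) : ℤ :=
  ∑ c, if EnhancedState.IsIncident c S S' then
    (-1) ^ (Finset.univ.filter fun c' => c' < c ∧ S.marker c' = -1).card else 0

/-- The component `C_{a,b}(D) → C_{a',b}(D)` of the boundary map; it is zero unless `a' = a - 2`.
Here `C_{a,b}(D)` is the free abelian group on the basis states of bidegree `(a,b)`. -/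
noncomputable def khovanovD (D : LinkDiagram) (a a' b : ℤ) :
    (D.BasisState a b → ℤ) →ₗ[ℤ] (D.BasisState a' b → ℤ) :=
  (Matrix.of fun (S' : D.BasisState a' b) (S : D.BasisState a b) =>
    S.1.incidence S'.1).mulVecLin

/-- The Khovanov homology `H_{a,b}(D)` of the unoriented framed link given by `D`. -/
abbrev KhovanovHomology (D : LinkDiagram) (a b : ℤ) : Type :=
  HomologyAt (D.khovanovD (a + 2) a b) (D.khovanovD a (a - 2) b)

end LinkDiagram

/-! Encode a Kauffman state by its set `s` of negative crossings. Adding a crossing to `s` whose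
edge joins two different components of `[G : s]` merges two circles, provided that circles
correspond to components so far. The circles always map onto the components (`componentOfCircle`).
If `|s| < ℓ`, no edge of `s` closes a cycle, so by induction the map is a bijection, and both sides
have `V - |s|` elements.

Reading `x` as a positive circle and `1` as a negative one turns graph states with `|s| < ℓ` into
Kauffman states. In bidegree `(i, j)` one gets `σ = E - 2i` and `τ = 2j - (V - i)`, hence `σ + 2τ =
E - 2V + 4j = b`. The condition `τ(S') = τ(S) + 1` says exactly that the degree is kept when two
circles merge, so the differentials agree as well, signs included. The two complexes therefore
coincide in cochain degrees below `ℓ`.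

If `i + 1 < ℓ`, the groups in degrees `i - 1`, `i`, `i + 1` all match, and so does the homology. If
`i + 1 = ℓ`, only the map into degree `i` matches. Since the next group is free and the composite of
consecutive maps is zero, the torsion of the homology is the torsion of the cokernel of this map.

The second case needs the square of the Khovanov boundary to vanish at the step where a circle may
split. `exists_isIncident_comm` does this: if the second crossing closes a cycle, the two crossings
join the same two components and can be interchanged. -/

/-! ## Homological algebra over `ℤ` -/

/-- Isomorphic sequences `A → B → C` have isomorphic homology. -/
theorem HomologyAt.nonempty_addEquiv {A B C A' B' C' : Type*}
    [AddCommGroup A] [AddCommGroup B] [AddCommGroup C]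
    [AddCommGroup A'] [AddCommGroup B'] [AddCommGroup C']
    {f : A →ₗ[ℤ] B} {g : B →ₗ[ℤ] C} {f' : A' →ₗ[ℤ] B'} {g' : B' →ₗ[ℤ] C'}
    (eA : A ≃ₗ[ℤ] A') (eB : B ≃ₗ[ℤ] B') (eC : C ≃ₗ[ℤ] C')
    (hf : ∀ x, eB (f x) = f' (eA x)) (hg : ∀ x, eC (g x) = g' (eB x)) :
    Nonempty (HomologyAt f g ≃+ HomologyAt f' g') := by
  have hker : (LinearMap.ker g).map (eB : B →ₗ[ℤ] B') = LinearMap.ker g' := by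
    ext y
    simp only [Submodule.mem_map, LinearMap.mem_ker]
    constructor
    · rintro ⟨x, hx, rfl⟩
      rw [LinearEquiv.coe_coe, ← hg, hx, map_zero]
    · intro hy
      refine ⟨eB.symm y, ?_, by simp⟩
      apply eC.injective
      rw [hg, LinearEquiv.apply_symm_apply, hy, map_zero]
  refine ⟨(Submodule.Quotient.equiv _ _ (eB.ofSubmodules _ _ hker) ?_).toAddEquiv⟩
  ext y
  simp only [Submodule.submoduleOf, Submodule.mem_map, Submodule.mem_comap, LinearMap.mem_range,
    Submodule.subtype_apply]
  constructor
  · rintro ⟨x, ⟨z, hz⟩, rfl⟩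
    refine ⟨eA z, ?_⟩
    rw [← hf, hz]
    rfl
  · rintro ⟨z, hz⟩
    refine ⟨(eB.ofSubmodules _ _ hker).symm y, ⟨eA.symm z, ?_⟩, by simp⟩
    apply eB.injective
    rw [hf, LinearEquiv.apply_symm_apply, hz]
    have h : (eB.ofSubmodules _ _ hker) ((eB.ofSubmodules _ _ hker).symm y) = y := by simp
    exact congrArg Subtype.val h.symm

/-- An injective map reflects torsion, so a preimage of a torsion element is torsion. Hence only the
torsion of the target has to be hit. -/
theorem Submodule.nonempty_torsion_addEquiv {M N : Type*} [AddCommGroup M] [AddCommGroup N]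
    (φ : M →ₗ[ℤ] N) (hφ : Function.Injective φ)
    (hsurj : ∀ y ∈ Submodule.torsion ℤ N, ∃ x, φ x = y) :
    Nonempty (Submodule.torsion ℤ M ≃+ Submodule.torsion ℤ N) := by
  have hmem : ∀ x ∈ Submodule.torsion ℤ M, φ x ∈ Submodule.torsion ℤ N := by
    intro x hx
    obtain ⟨n, hn⟩ := (Submodule.mem_torsion_iff x).1 hx
    refine (Submodule.mem_torsion_iff _).2 ⟨n, ?_⟩
    have h := congrArg φ hn
    rwa [map_zero, Submonoid.smul_def, map_smul] at h
  refine ⟨(LinearEquiv.ofBijective (φ.restrict hmem) ⟨?_, ?_⟩).toAddEquiv⟩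
  · intro x y h
    exact Subtype.ext (hφ (congrArg Subtype.val h))
  · rintro ⟨y, hy⟩
    obtain ⟨x, rfl⟩ := hsurj y hy
    refine ⟨⟨x, ?_⟩, rfl⟩
    obtain ⟨n, hn⟩ := (Submodule.mem_torsion_iff _).1 hy
    refine (Submodule.mem_torsion_iff _).2 ⟨n, hφ ?_⟩
    rw [map_zero, ← hn, Submonoid.smul_def, Submonoid.smul_def, map_smul]

/-- If `C` is torsion-free, then the torsion of the homology of a complex `A → B → C` is
that of the cokernel of `A → B`. -/
theorem HomologyAt.nonempty_torsion_addEquiv {A B C : Type*}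
    [AddCommGroup A] [AddCommGroup B] [AddCommGroup C] [Module.IsTorsionFree ℤ C]
    {f : A →ₗ[ℤ] B} {g : B →ₗ[ℤ] C} (hgf : ∀ x, g (f x) = 0) :
    Nonempty (Submodule.torsion ℤ (HomologyAt f g) ≃+
      Submodule.torsion ℤ (B ⧸ LinearMap.range f)) := by
  refine Submodule.nonempty_torsion_addEquiv
    (Submodule.mapQ ((LinearMap.range f).submoduleOf (LinearMap.ker g)) (LinearMap.range f)
      (LinearMap.ker g).subtype (by rw [Submodule.submoduleOf])) ?_ ?_
  · rw [← LinearMap.ker_eq_bot, eq_bot_iff]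
    intro x hx
    obtain ⟨x, rfl⟩ := Submodule.Quotient.mk_surjective _ x
    rw [LinearMap.mem_ker] at hx
    have hx := (Submodule.Quotient.mk_eq_zero (LinearMap.range f)).1 hx
    exact (Submodule.Quotient.mk_eq_zero _).2 hx
  · intro y hy
    obtain ⟨y, rfl⟩ := Submodule.Quotient.mk_surjective _ y
    obtain ⟨n, hn⟩ := (Submodule.mem_torsion_iff _).1 hy
    rw [Submonoid.smul_def, ← Submodule.Quotient.mk_smul, Submodule.Quotient.mk_eq_zero] at hn
    obtain ⟨x, hx⟩ := hn
    -- A multiple of `y` is a boundary, so a multiple of `g y` vanishes. As `C` is torsion-free, `y`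
    -- is already a cycle.
    have h0 : (n : ℤ) • g y = 0 := by rw [← map_smul, ← hx, hgf]
    have hy0 : g y = 0 := (smul_eq_zero.1 h0).resolve_left (nonZeroDivisors.ne_zero n.2)
    exact ⟨Submodule.Quotient.mk ⟨y, hy0⟩, rfl⟩

/-- The torsion of the homology of a complex `A → B → C` with `C` torsion-free depends only on
`A → B`. -/
theorem HomologyAt.nonempty_torsion_addEquiv_of_equiv {A B C A' B' C' : Type*}
    [AddCommGroup A] [AddCommGroup B] [AddCommGroup C] [Module.IsTorsionFree ℤ C]
    [AddCommGroup A'] [AddCommGroup B'] [AddCommGroup C'] [Module.IsTorsionFree ℤ C']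
    {f : A →ₗ[ℤ] B} {g : B →ₗ[ℤ] C} {f' : A' →ₗ[ℤ] B'} {g' : B' →ₗ[ℤ] C'}
    (hgf : ∀ x, g (f x) = 0) (hgf' : ∀ x, g' (f' x) = 0)
    (eA : A ≃ₗ[ℤ] A') (eB : B ≃ₗ[ℤ] B') (hf : ∀ x, eB (f x) = f' (eA x)) :
    Nonempty (Submodule.torsion ℤ (HomologyAt f g) ≃+
      Submodule.torsion ℤ (HomologyAt f' g')) := by
  obtain ⟨e₁⟩ := HomologyAt.nonempty_torsion_addEquiv hgf
  obtain ⟨e₂⟩ := HomologyAt.nonempty_torsion_addEquiv hgf'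
  have hrange : (LinearMap.range f).map (eB : B →ₗ[ℤ] B') = LinearMap.range f' := by
    ext y
    simp only [Submodule.mem_map, LinearMap.mem_range]
    constructor
    · rintro ⟨_, ⟨z, rfl⟩, rfl⟩
      exact ⟨eA z, (hf z).symm⟩
    · rintro ⟨z, rfl⟩
      exact ⟨_, ⟨eA.symm z, rfl⟩, by simp [hf]⟩
  let e := Submodule.Quotient.equiv _ _ eB hrange
  obtain ⟨e₃⟩ := Submodule.nonempty_torsion_addEquiv e.toLinearMap e.injective
    (fun y _ => e.surjective y)
  exact ⟨(e₁.trans e₃).trans e₂.symm⟩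

/-! ### Matrices of differentials and signed cubes. -/

/-- The matrix of a linear map in permuted bases. -/
theorem Matrix.funCongrLeft_mulVecLin {A B A' B' : Type*} [Fintype A] [Fintype A']
    (M : Matrix B A ℤ) (M' : Matrix B' A' ℤ) (φA : A ≃ A') (φB : B ≃ B')
    (h : ∀ b a, M' (φB b) (φA a) = M b a) (x : A → ℤ) :
    LinearEquiv.funCongrLeft ℤ ℤ φB.symm (M.mulVecLin x) =
      M'.mulVecLin (LinearEquiv.funCongrLeft ℤ ℤ φA.symm x) := by
  funext b'
  obtain ⟨b, rfl⟩ := φB.surjective b'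
  simp only [LinearEquiv.funCongrLeft_apply, LinearMap.funLeft_apply, Matrix.mulVecLin_apply,
    Equiv.symm_apply_apply, Matrix.mulVec, dotProduct]
  rw [← φA.sum_comp]
  simp [h]

theorem Finset.sum_prod_ite_eq_ite {ι R : Type*} [Fintype ι] [CommRing R] (P Q : ι → Prop)
    [DecidablePred P] [DecidablePred Q] [Decidable (∃ i, P i ∧ Q i)] (r : R)
    (hP : ∀ i i', P i → P i' → i = i') :
    (∑ i, if P i ∧ Q i then r else 0) = if ∃ i, P i ∧ Q i then r else 0 := by
  split_ifs with h
  · obtain ⟨i, hi⟩ := h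
    rw [Finset.sum_eq_single i, if_pos hi]
    · exact fun i' _ hne => if_neg fun h' => hne (hP _ _ h'.1 hi.1)
    · exact fun h => absurd (Finset.mem_univ _) h
  · exact Finset.sum_eq_zero fun i _ => if_neg fun h' => h ⟨i, h'⟩

open Classical in
/-- The square of the differential of a signed cube of partial maps vanishes if the faces of
the cube commute. -/
theorem sum_signed_incidence_mul_eq_zero {A B C E : Type*} [Fintype B] [Fintype E] [LinearOrder E]
    (sA : A → Finset E) (sB : B → Finset E) (R : E → A → B → Prop) (R' : E → B → C → Prop)
    (hR : ∀ e a b, R e a b → e ∉ sA a ∧ sB b = insert e (sA a))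
    (hR' : ∀ e b c, R' e b c → e ∉ sB b)
    (huniq : ∀ e a b b', R e a b → R e a b' → b = b')
    (hcomm : ∀ e e' a c, (∃ b, R e a b ∧ R' e' b c) → ∃ b, R e' a b ∧ R' e b c) (a : A) (c : C) :
    ∑ b, (∑ e', if R' e' b c then (-1 : ℤ) ^ ((sB b).filter (· < e')).card else 0) *
      (∑ e, if R e a b then (-1 : ℤ) ^ ((sA a).filter (· < e)).card else 0) = 0 := by
  -- `F e e'` is the contribution of going from `a` to `c` by `e` and then `e'`. By `huniq` at most
  -- one intermediate `b` occurs.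
  let F : E → E → ℤ := fun e e' => if ∃ b, R e a b ∧ R' e' b c then
    (-1) ^ ((sA a).filter (· < e)).card * (-1) ^ ((insert e (sA a)).filter (· < e')).card else 0
  have h1 : ∀ e e', F e e' = ∑ b, (if R' e' b c then (-1 : ℤ) ^ ((sB b).filter (· < e')).card else 0)
      * (if R e a b then (-1 : ℤ) ^ ((sA a).filter (· < e)).card else 0) := by
    intro e e'
    refine (Finset.sum_prod_ite_eq_ite (fun b => R e a b) (fun b => R' e' b c) _ (huniq e a)).symm.trans ?_
    refine Finset.sum_congr rfl fun b _ => ?_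
    by_cases h : R e a b
    · by_cases h' : R' e' b c
      · simp only [h, h', and_self, if_true]
        rw [(hR _ _ _ h).2, mul_comm]
      · simp [h']
    · simp [h]
  -- Only when the smaller edge is inserted first does it raise the count for the other edge, so the
  -- two orders have opposite signs.
  have hF : ∀ e e', F e' e = - F e e' := by
    intro e e'
    by_cases h : ∃ b, R e a b ∧ R' e' b c
    · have h' := hcomm _ _ _ _ h
      obtain ⟨b, hb, hb'⟩ := h
      have hb2 := hR' _ _ _ hb'
      rw [(hR _ _ _ hb).2, Finset.mem_insert, not_or] at hb2
      have he := (hR _ _ _ hb).1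
      have hcard : ∀ x y : E, x ∉ sA a → ((insert x (sA a)).filter (· < y)).card
          = ((sA a).filter (· < y)).card + if x < y then 1 else 0 := by
        intro x y hx
        rw [Finset.filter_insert]
        split_ifs
        · rw [Finset.card_insert_of_notMem (fun h => hx (Finset.mem_filter.1 h).1)]
        · rfl
      simp only [F, if_pos h', if_pos (⟨b, hb, hb'⟩ : ∃ b, R e a b ∧ R' e' b c)]
      rw [hcard _ _ he, hcard _ _ hb2.2]
      rcases lt_or_gt_of_ne hb2.1 with hlt | hlt
      · rw [if_pos hlt, if_neg hlt.asymm]; ring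
      · rw [if_pos hlt, if_neg hlt.asymm]; ring
    · have h' : ¬ ∃ b, R e' a b ∧ R' e b c := fun h' => h (hcomm _ _ _ _ h')
      simp only [F, if_neg h, if_neg h', neg_zero]
  have hsum : (∑ b, (∑ e', if R' e' b c then (-1 : ℤ) ^ ((sB b).filter (· < e')).card else 0) *
      (∑ e, if R e a b then (-1 : ℤ) ^ ((sA a).filter (· < e)).card else 0))
      = ∑ e, ∑ e', F e e' := by
    simp only [h1, Finset.sum_mul_sum]
    rw [Finset.sum_comm]
    conv_rhs => rw [Finset.sum_comm]
    exact Finset.sum_congr rfl fun e _ => Finset.sum_comm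
  rw [hsum]
  have hanti : (∑ e, ∑ e', F e e') = - ∑ e, ∑ e', F e e' := by
    conv_lhs => rw [Finset.sum_comm]
    simp only [← Finset.sum_neg_distrib]
    exact Finset.sum_congr rfl fun e _ => Finset.sum_congr rfl fun e' _ => hF e e'
  linarith

/-! ## Merging two points -/

section Merge

variable {A B : Type*} [Fintype A] [Fintype B] {q : A → B} {a₀ b₀ : A}

/-- Deleting `a₀` makes `q` bijective, because `b₀` still represents the merged class. -/
theorem Fintype.card_eq_card_add_one_of_merge (hq : Function.Surjective q) (hab : a₀ ≠ b₀)
    (hqq : ∀ x y, q x = q y ↔ x = y ∨ ((x = a₀ ∨ x = b₀) ∧ (y = a₀ ∨ y = b₀))) :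
    Fintype.card A = Fintype.card B + 1 := by
  classical
  have h : Function.Bijective (fun x : {x // x ≠ a₀} => q x) := by
    constructor
    · rintro ⟨x, hx⟩ ⟨y, hy⟩ hxy
      have := (hqq x y).1 hxy
      apply Subtype.ext
      show x = y
      rcases this with h | ⟨h1, h2⟩
      · exact h
      · rw [h1.resolve_left hx, h2.resolve_left hy]
    · intro b
      obtain ⟨x, rfl⟩ := hq b
      by_cases hx : x = a₀
      · exact ⟨⟨b₀, hab.symm⟩, (hqq _ _).2 (Or.inr ⟨Or.inr rfl, Or.inl hx⟩)⟩
      · exact ⟨⟨x, hx⟩, rfl⟩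
  rw [← Fintype.card_of_bijective h, Fintype.card_subtype_compl, Fintype.card_subtype_eq]
  have : 0 < Fintype.card A := Fintype.card_pos_iff.2 ⟨a₀⟩
  omega

-- Away from the merged class the fibers are single points, and the one remaining value is forced by
-- equality of the totals. This translates the product rule of the chromatic differential into
-- Khovanov's rule, which keeps the other signs and prescribes `τ`.
open Classical in
theorem fiber_sum_iff_of_merge (hq : Function.Surjective q)
    (hqq : ∀ x y, q x = q y ↔ x = y ∨ ((x = a₀ ∨ x = b₀) ∧ (y = a₀ ∨ y = b₀)))
    (w : A → ℕ) (w' : B → ℕ) (hw : ∑ y, w' y = ∑ x, w x) :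
    (∀ y, w' y = ∑ x with q x = y, w x) ↔ ∀ x, x ≠ a₀ → x ≠ b₀ → w' (q x) = w x := by
  have hfib : ∀ x, x ≠ a₀ → x ≠ b₀ → ∑ z with q z = q x, w z = w x := by
    intro x ha hb
    have : (Finset.univ.filter fun z => q z = q x) = {x} := by
      ext z
      simp [hqq, ha, hb]
    rw [this, Finset.sum_singleton]
  constructor
  · intro h x ha hb
    rw [h, hfib x ha hb]
  · intro h
    have hother : ∀ y, y ≠ q a₀ → w' y = ∑ x with q x = y, w x := by
      intro y hy
      obtain ⟨x, rfl⟩ := hq y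
      have ha : x ≠ a₀ := fun h => hy (h ▸ rfl)
      have hb : x ≠ b₀ := fun h => hy ((hqq _ _).2 (Or.inr ⟨Or.inr h, Or.inl rfl⟩))
      rw [h x ha hb, hfib x ha hb]
    intro y
    by_cases hy : y = q a₀
    · have htot : ∑ y, w' y = ∑ y, ∑ x with q x = y, w x := by
        classical exact hw.trans (Finset.sum_fiberwise _ _ _).symm
      rw [← Finset.add_sum_erase _ _ (Finset.mem_univ (q a₀)),
        ← Finset.add_sum_erase _ (fun y => ∑ x with q x = y, w x) (Finset.mem_univ (q a₀)),
        Finset.sum_congr rfl (fun z hz => hother z (Finset.ne_of_mem_erase hz))] at htot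
      rw [hy]
      exact Nat.add_right_cancel htot
    · exact hother y hy

end Merge

/-! ## Components of spanning subgraphs -/

namespace Graph

section Components

variable {α β : Type*} {G : Graph α β}

theorem stateComponent_surjective (s : Finset β) : Function.Surjective (G.stateComponent s) :=
  Quot.mk_surjective

theorem stateComponent_eq_of_isLink {s : Finset β} {e : β} (he : e ∈ s) {u v : G.vertexSet}
    (h : G.IsLink e u v) : G.stateComponent s u = G.stateComponent s v :=
  Quot.sound ⟨e, by simp [he, h]⟩

/-- Being in the same component is the smallest equivalence relation containing the links by edges
of `s`. -/
theorem rel_of_stateComponent_eq {s : Finset β} {r : G.vertexSet → G.vertexSet → Prop}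
    (hr : Equivalence r) (h : ∀ e ∈ s, ∀ u v : G.vertexSet, G.IsLink e u v → r u v)
    {u v : G.vertexSet} (huv : G.stateComponent s u = G.stateComponent s v) : r u v := by
  replace huv := Quot.eqvGen_exact huv
  induction huv with
  | rel x y hxy =>
    obtain ⟨e, he⟩ := hxy
    simp only [restrict_isLink] at he
    exact h e (by simpa using he.1) x y he.2
  | refl x => exact hr.refl x
  | symm x y _ ih => exact hr.symm ih
  | trans x y z _ _ ih₁ ih₂ => exact hr.trans ih₁ ih₂

theorem stateComponent_eq_of_subset {s t : Finset β} (h : s ⊆ t) {u v : G.vertexSet}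
    (huv : G.stateComponent s u = G.stateComponent s v) :
    G.stateComponent t u = G.stateComponent t v :=
  rel_of_stateComponent_eq (r := fun u v => G.stateComponent t u = G.stateComponent t v)
    ⟨fun _ => rfl, fun h => h.symm, fun h h' => h.trans h'⟩
    (fun _ he _ _ hl => stateComponent_eq_of_isLink (h he) hl) huv

/-- The component of `[G : t]` that contains a given component of `[G : s]`, where `s ⊆ t`. -/
def stateComponentMap {s t : Finset β} (h : s ⊆ t) : G.StateComponent s → G.StateComponent t :=
  Quot.lift (G.stateComponent t) fun _ _ huv =>
    stateComponent_eq_of_subset h (Quot.sound huv)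

@[simp]
theorem stateComponentMap_stateComponent {s t : Finset β} (h : s ⊆ t) (v : G.vertexSet) :
    stateComponentMap h (G.stateComponent s v) = G.stateComponent t v :=
  rfl

theorem stateComponentMap_stateComponentMap {s t r : Finset β} (h : s ⊆ t) (h' : t ⊆ r)
    (c : G.StateComponent s) :
    stateComponentMap h' (stateComponentMap h c) = stateComponentMap (h.trans h') c := by
  obtain ⟨v, rfl⟩ := stateComponent_surjective s c
  rfl

theorem stateComponentMap_surjective {s t : Finset β} (h : s ⊆ t) :
    Function.Surjective (stateComponentMap (G := G) h) := by
  intro c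
  obtain ⟨v, rfl⟩ := stateComponent_surjective t c
  exact ⟨G.stateComponent s v, rfl⟩

/-- The right-hand side is itself an equivalence relation containing the links by `s` and by `e`.
The ends of `e` may already lie in one component. -/
theorem stateComponent_insert_eq_iff [DecidableEq β] {s : Finset β} {e : β} {u v : G.vertexSet}
    (he : G.IsLink e u v) (x y : G.vertexSet) :
    G.stateComponent (insert e s) x = G.stateComponent (insert e s) y ↔
      G.stateComponent s x = G.stateComponent s y ∨
        ((G.stateComponent s x = G.stateComponent s u ∨
            G.stateComponent s x = G.stateComponent s v) ∧
          (G.stateComponent s y = G.stateComponent s u ∨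
            G.stateComponent s y = G.stateComponent s v)) := by
  constructor
  · intro h
    refine rel_of_stateComponent_eq (r := fun x y =>
      G.stateComponent s x = G.stateComponent s y ∨
        ((G.stateComponent s x = G.stateComponent s u ∨
            G.stateComponent s x = G.stateComponent s v) ∧
          (G.stateComponent s y = G.stateComponent s u ∨
            G.stateComponent s y = G.stateComponent s v))) ⟨?_, ?_, ?_⟩ ?_ h
    · exact fun x => Or.inl rfl
    · rintro x y (h | h)
      · exact Or.inl h.symm
      · exact Or.inr h.symm
    · rintro x y z (h | h) (h' | h')
      · exact Or.inl (h.trans h')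
      · exact Or.inr ⟨h ▸ h'.1, h'.2⟩
      · exact Or.inr ⟨h.1, h' ▸ h.2⟩
      · exact Or.inr ⟨h.1, h'.2⟩
    · intro e' he' x y hxy
      rcases Finset.mem_insert.1 he' with rfl | he'
      · right
        rcases he.eq_and_eq_or_eq_and_eq hxy with ⟨h1, h2⟩ | ⟨h1, h2⟩
        · rw [Subtype.ext h1, Subtype.ext h2]; simp
        · rw [Subtype.ext h1, Subtype.ext h2]; simp
      · exact Or.inl (stateComponent_eq_of_isLink he' hxy)
  · have huv := stateComponent_eq_of_isLink (Finset.mem_insert_self e s) he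
    have hm : ∀ {x y : G.vertexSet}, G.stateComponent s x = G.stateComponent s y →
        G.stateComponent (insert e s) x = G.stateComponent (insert e s) y :=
      fun h => stateComponent_eq_of_subset (Finset.subset_insert _ _) h
    rintro (h | ⟨h1 | h1, h2 | h2⟩)
    · exact hm h
    · exact (hm h1).trans (hm h2).symm
    · exact (hm h1).trans (huv.trans (hm h2).symm)
    · exact (hm h1).trans (huv.symm.trans (hm h2).symm)
    · exact (hm h1).trans (hm h2).symm

theorem stateComponentMap_insert_eq_iff [DecidableEq β] {s : Finset β} {e : β} {u v : G.vertexSet}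
    (he : G.IsLink e u v) (x y : G.StateComponent s) :
    stateComponentMap (Finset.subset_insert e s) x = stateComponentMap (Finset.subset_insert e s) y
      ↔ x = y ∨ ((x = G.stateComponent s u ∨ x = G.stateComponent s v) ∧
          (y = G.stateComponent s u ∨ y = G.stateComponent s v)) := by
  obtain ⟨x, rfl⟩ := stateComponent_surjective s x
  obtain ⟨y, rfl⟩ := stateComponent_surjective s y
  exact stateComponent_insert_eq_iff he x y

/-! ### Girth and the number of components. -/

/-- An edge whose ends are already connected by edges in `s` closes up a cycle. -/
theorem girth_le_card_insert [DecidableEq β] {s : Finset β} {e : β} {u v : G.vertexSet}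
    (hes : e ∉ s) (he : G.IsLink e u v) (huv : G.stateComponent s u = G.stateComponent s v) :
    G.girth ≤ ((insert e s).card : ℕ∞) := by
  -- Forgetting loops and multiplicities loses no connectivity and makes simple paths available. An
  -- edge of `s` is chosen afterwards for each step of the path.
  let H : SimpleGraph G.vertexSet := SimpleGraph.fromRel fun x y => ∃ f ∈ s, G.IsLink f x y
  have hreach : H.Reachable u v := by
    refine rel_of_stateComponent_eq (r := H.Reachable)
      ⟨fun x => SimpleGraph.Reachable.refl x, fun h => h.symm, fun h h' => h.trans h'⟩ ?_ huv
    intro f hf x y hxy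
    by_cases hne : x = y
    · rw [hne]
    · exact SimpleGraph.Adj.reachable ((SimpleGraph.fromRel_adj _ _ _).2
        ⟨hne, Or.inl ⟨f, hf, hxy⟩⟩)
  classical
  obtain ⟨p, hp⟩ := hreach.exists_isPath
  have hlink : ∀ k : Fin (p.length + 1), k.val < p.length →
      ∃ f ∈ s, G.IsLink f (p.getVert k) (p.getVert (k + 1)) := by
    intro k hk
    obtain ⟨_, ⟨f, hf, h⟩ | ⟨f, hf, h⟩⟩ := (SimpleGraph.fromRel_adj _ _ _).1 (p.adj_getVert_succ hk)
    · exact ⟨f, hf, h⟩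
    · exact ⟨f, hf, h.symm⟩
  have : Nonempty β := ⟨e⟩
  choose! f hfs hf using hlink
  have hinj : ∀ a b : ℕ, a ≤ p.length → b ≤ p.length →
      (p.getVert a : α) = p.getVert b → a = b :=
    fun a b ha hb h => hp.getVert_injOn ha hb (Subtype.ext h)
  have hfinj : ∀ k l : Fin (p.length + 1), k.val < p.length → l.val < p.length →
      f k = f l → k = l := by
    intro k l hk hl hkl
    have h1 := hf k hk
    rw [hkl] at h1
    rcases h1.eq_and_eq_or_eq_and_eq (hf l hl) with ⟨h, _⟩ | ⟨h, h'⟩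
    · exact Fin.ext (hinj _ _ hk.le hl.le h)
    -- An edge traversed in opposite directions would give `k = l + 1` and `k + 1 = l`.
    · have h2 := hinj _ _ hk.le hl h
      have h3 := hinj _ _ hk hl.le h'
      omega
  have hcycle : G.HasCycleOfLengthSucc p.length := by
    -- The edge `e` takes the last position and leads from `v` back to `u`, where `k + 1` wraps
    -- around in `Fin`. If `u = v`, the path has length `0` and `e` is a loop.
    refine ⟨fun k => p.getVert k, fun k => if k.val < p.length then f k else e, ?_, ?_, ?_⟩
    · intro k l h
      exact Fin.ext (hinj _ _ (by omega) (by omega) h)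
    · intro k l h
      by_cases hk : k.val < p.length
      · by_cases hl : l.val < p.length
        · simp only [hk, hl, if_true] at h
          exact hfinj k l hk hl h
        · simp only [hk, hl, if_true, if_false] at h
          exact absurd (h ▸ hfs k hk) hes
      · by_cases hl : l.val < p.length
        · simp only [hk, hl, if_true, if_false] at h
          exact absurd (h ▸ hfs l hl) hes
        · exact Fin.ext (by omega)
    · intro k
      by_cases hk : k.val < p.length
      · simp only [hk, if_true]
        have hk1 : ((k + 1 : Fin (p.length + 1)) : ℕ) = k + 1 := by
          rw [Fin.val_add_one_of_lt]
          exact Fin.lt_def.2 (by simpa using hk)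
        rw [hk1]
        exact hf k hk
      · have hkl : k = Fin.last _ := Fin.ext (by simp; omega)
        subst hkl
        simp only [Fin.val_last, lt_irrefl, if_false, Fin.last_add_one, Fin.val_zero,
          SimpleGraph.Walk.getVert_length, SimpleGraph.Walk.getVert_zero]
        exact he.symm
  have hlen : p.length ≤ s.card := by
    have hsub : (Finset.univ.image fun k : Fin p.length => f k.castSucc) ⊆ s := by
      intro x hx
      obtain ⟨k, _, rfl⟩ := Finset.mem_image.1 hx
      exact hfs _ k.2
    have := Finset.card_le_card hsub
    rwa [Finset.card_image_of_injective, Finset.card_univ, Fintype.card_fin] at this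
    intro k l h
    exact Fin.castSucc_injective _ (hfinj _ _ k.2 l.2 h)
  calc G.girth ≤ (p.length : ℕ∞) + 1 := iInf₂_le p.length hcycle
    _ ≤ ((insert e s).card : ℕ∞) := by
      rw [Finset.card_insert_of_notMem hes]
      exact_mod_cast Nat.add_le_add_right hlen 1

theorem stateComponent_ne_of_card_lt_girth [DecidableEq β] {s : Finset β} {e : β}
    {u v : G.vertexSet} (hes : e ∉ s) (he : G.IsLink e u v)
    (hs : ((insert e s).card : ℕ∞) < G.girth) :
    G.stateComponent s u ≠ G.stateComponent s v :=
  fun h => hs.not_ge (girth_le_card_insert hes he h)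

theorem card_stateComponent_empty [Finite α] :
    Fintype.card (G.StateComponent ∅) = G.vertexSet.ncard := by
  rw [← Nat.card_coe_set_eq, ← Nat.card_eq_fintype_card]
  refine (Nat.card_congr (Equiv.ofBijective (G.stateComponent ∅)
    ⟨fun u v h => ?_, stateComponent_surjective ∅⟩)).symm
  exact rel_of_stateComponent_eq (r := fun u v => u = v) eq_equivalence (by simp) h

/-- Below the girth `[G : s]` is a forest: each added edge merges two different components, since
otherwise it would close too short a cycle. -/
theorem card_stateComponent_add_card [Finite α] {s : Finset β} (hsE : (s : Set β) ⊆ G.edgeSet)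
    (hs : (s.card : ℕ∞) < G.girth) :
    Fintype.card (G.StateComponent s) + s.card = G.vertexSet.ncard := by
  classical
  induction s using Finset.induction_on with
  | empty => simp [card_stateComponent_empty]
  | insert e s hes ih =>
    have hle : s.card ≤ (insert e s).card := Finset.card_le_card (Finset.subset_insert _ _)
    have ih := ih (fun x hx => hsE (by simp at hx; simp [hx]))
      (lt_of_le_of_lt (by exact_mod_cast hle) hs)
    obtain ⟨u, v, huv⟩ := G.exists_isLink_of_mem_edgeSet (hsE (by simp : e ∈ _))
    have h := Fintype.card_eq_card_add_one_of_merge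
      (stateComponentMap_surjective (G := G) (Finset.subset_insert e s))
      (stateComponent_ne_of_card_lt_girth (u := ⟨u, huv.left_mem⟩) (v := ⟨v, huv.right_mem⟩)
        hes huv hs) (stateComponentMap_insert_eq_iff huv)
    rw [Finset.card_insert_of_notMem hes]
    omega

/-! ### Multiplication of monomials along inclusions of edge sets. -/

/-- The exponents of the product of the monomials on the components of `[G : s]` that lie in a
component of `[G : t]`. -/
noncomputable def pushWeight [Finite α] {s t : Finset β} (h : s ⊆ t) (w : G.StateComponent s → ℕ)
    (c' : G.StateComponent t) : ℕ :=
  open Classical in ∑ c with stateComponentMap h c = c', w c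

theorem pushWeight_pushWeight [Finite α] {s t r : Finset β} (h : s ⊆ t) (h' : t ⊆ r)
    (w : G.StateComponent s → ℕ) (c : G.StateComponent r) :
    pushWeight h' (pushWeight h w) c = pushWeight (h.trans h') w c := by
  classical
  unfold pushWeight
  rw [← Finset.sum_fiberwise_of_maps_to (t := {c' | stateComponentMap h' c' = c})
    (g := stateComponentMap h) (fun x hx => by
      simpa [stateComponentMap_stateComponentMap] using hx)]
  refine Finset.sum_congr rfl fun c' hc' => Finset.sum_congr ?_ fun _ _ => rfl
  ext x
  simp only [Finset.mem_filter, Finset.mem_univ, true_and] at hc' ⊢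
  refine ⟨fun hx => ⟨?_, hx⟩, fun hx => hx.2⟩
  rw [← stateComponentMap_stateComponentMap h h', hx, hc']

theorem sum_pushWeight [Finite α] {s t : Finset β} (h : s ⊆ t) (w : G.StateComponent s → ℕ) :
    ∑ c, pushWeight h w c = ∑ c, w c :=
  open Classical in Finset.sum_fiberwise _ _ _

/-- Exponents only grow under multiplication, so a product that is nonzero at the end is nonzero at
every intermediate stage, in any order of the edges. -/
theorem pushWeight_le_pushWeight [Finite α] {s t r : Finset β} (h : s ⊆ t) (h' : t ⊆ r)
    (w : G.StateComponent s → ℕ) (c : G.StateComponent t) :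
    pushWeight h w c ≤ pushWeight (h.trans h') w (stateComponentMap h' c) := by
  rw [← pushWeight_pushWeight h h']
  classical
  exact Finset.single_le_sum (f := pushWeight h w) (fun _ _ => Nat.zero_le _) (by simp)

end Components

/-! ## The chromatic cochain complex -/

namespace EnhancedState

variable {α β : Type*} {G : Graph α β} {m : ℕ}

variable [Finite α] [DecidableEq β]

/-- The inclusion appears as an existential because `pushWeight` takes it as an argument, while it
only follows from the preceding conjunct. -/
theorem isImage_iff {e : β} {S S' : G.EnhancedState m} :
    IsImage e S S' ↔ e ∉ S.edges ∧ S'.edges = insert e S.edges ∧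
      ∃ h : S.edges ⊆ S'.edges, ∀ c', (S'.weight c' : ℕ) =
        pushWeight h (fun c => (S.weight c : ℕ)) c' := by
  unfold IsImage
  refine and_congr_right fun he => and_congr_right fun hS => ?_
  have hsub : S.edges ⊆ S'.edges := hS ▸ Finset.subset_insert _ _
  rw [exists_prop_of_true hsub]
  refine forall_congr' fun c' => ?_
  unfold pushWeight
  congr! 3 with c
  obtain ⟨v, rfl⟩ := stateComponent_surjective S.edges c
  constructor
  · rintro ⟨v', h, rfl⟩
    rw [← h]
    rfl
  · intro h
    exact ⟨v, rfl, h⟩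

theorem IsImage.degree_eq {e : β} {S S' : G.EnhancedState m} (h : IsImage e S S') :
    S'.degree = S.degree := by
  obtain ⟨_, _, hsub, hw⟩ := isImage_iff.1 h
  unfold degree
  simp only [hw, sum_pushWeight]

theorem IsImage.eq {e : β} {S S₁ S₂ : G.EnhancedState m} (h₁ : IsImage e S S₁)
    (h₂ : IsImage e S S₂) : S₁ = S₂ := by
  obtain ⟨_, h₁, hsub₁, hw₁⟩ := isImage_iff.1 h₁
  obtain ⟨_, h₂, hsub₂, hw₂⟩ := isImage_iff.1 h₂
  obtain ⟨s₁, hs₁, w₁⟩ := S₁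
  obtain ⟨s₂, hs₂, w₂⟩ := S₂
  obtain rfl : s₁ = s₂ := h₁.trans h₂.symm
  congr 1
  funext c
  exact Fin.ext ((hw₁ c).trans (hw₂ c).symm)

theorem exists_isImage {e : β} {S : G.EnhancedState m} (he : e ∉ S.edges) (heE : e ∈ G.edgeSet)
    (hw : ∀ c, pushWeight (Finset.subset_insert e S.edges) (fun c => (S.weight c : ℕ)) c < m) :
    ∃ S', S'.edges = insert e S.edges ∧ IsImage e S S' := by
  refine ⟨⟨insert e S.edges, ?_, fun c => ⟨_, hw c⟩⟩, rfl,
    isImage_iff.2 ⟨he, rfl, Finset.subset_insert e S.edges, fun c => rfl⟩⟩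
  rw [Finset.coe_insert]
  exact Set.insert_subset heE S.edges_subset

theorem IsImage.exists_comm {e e' : β} {S S' S'' : G.EnhancedState m} (h : IsImage e S S')
    (h' : IsImage e' S' S'') : ∃ S₁, IsImage e' S S₁ ∧ IsImage e S₁ S'' := by
  obtain ⟨he, hS', hsub, hw⟩ := isImage_iff.1 h
  obtain ⟨he', hS'', hsub', hw'⟩ := isImage_iff.1 h'
  rw [hS', Finset.mem_insert, not_or] at he'
  have hsub₁ : insert e' S.edges ⊆ S''.edges := by
    rw [hS'', hS']
    exact Finset.insert_subset_insert _ (Finset.subset_insert _ _)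
  have hw'' : ∀ c, (S''.weight c : ℕ) =
      pushWeight (hsub.trans hsub') (fun c => (S.weight c : ℕ)) c := by
    intro c
    rw [hw', ← pushWeight_pushWeight hsub hsub']
    congr 1
    funext c'
    exact hw c'
  obtain ⟨S₁, hS₁, hi⟩ := exists_isImage (S := S) he'.2
    -- The exponents after adding `e'` alone are bounded by those of `S''`, which are less than `m`.
    -- So the product in the other order does not vanish.
    (S''.edges_subset (hsub₁ (Finset.mem_insert_self _ _))) (fun c =>
      (pushWeight_le_pushWeight (Finset.subset_insert e' S.edges) hsub₁ _ c).trans_lt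
        ((hw'' _).symm.trans_lt (S''.weight _).2))
  refine ⟨S₁, hi, isImage_iff.2 ⟨?_, ?_, hS₁ ▸ hsub₁, fun c => ?_⟩⟩
  · rw [hS₁, Finset.mem_insert, not_or]
    exact ⟨fun h => he'.1 h.symm, he⟩
  · rw [hS₁, hS'', hS', Finset.insert_comm]
  · obtain ⟨_, _, hsub₂, hw₂⟩ := isImage_iff.1 hi
    rw [hw'', ← pushWeight_pushWeight hsub₂ (hS₁ ▸ hsub₁)]
    congr 1
    funext c'
    exact (hw₂ c').symm

end EnhancedState

section Differential

variable {α β : Type*} [Finite α] [Fintype β] [LinearOrder β] {G : Graph α β} {m : ℕ}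

theorem chromaticD_chromaticD (i j : ℤ) (x : G.BasisState m (i - 1) j → ℤ) :
    G.chromaticD m i (i + 1) j (G.chromaticD m (i - 1) i j x) = 0 := by
  classical
  unfold chromaticD
  rw [Matrix.mulVecLin_apply, Matrix.mulVecLin_apply, Matrix.mulVec_mulVec]
  refine (congrArg (Matrix.mulVec · x) ?_).trans (Matrix.zero_mulVec x)
  ext S'' S
  rw [Matrix.mul_apply]
  refine sum_signed_incidence_mul_eq_zero (fun S : G.BasisState m (i - 1) j => S.1.edges)
    (fun S' : G.BasisState m i j => S'.1.edges)
    (fun e S S' => EnhancedState.IsImage e S.1 S'.1)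
    (fun e S' S'' => EnhancedState.IsImage e S'.1 S''.1)
    (fun e S S' h => ⟨h.1, h.2.1⟩) (fun e S' S'' h => h.1)
    (fun e S S₁ S₂ h₁ h₂ => Subtype.ext (h₁.eq h₂)) ?_ S S''
  rintro e e' S S'' ⟨S', h, h'⟩
  obtain ⟨S₁, h₁, h₁'⟩ := h.exists_comm h'
  refine ⟨⟨S₁, ?_, ?_⟩, h₁, h₁'⟩
  · rw [h₁.2.1, Finset.card_insert_of_notMem h₁.1]
    have := S.2.1
    push_cast
    omega
  · rw [h₁.degree_eq]
    exact S.2.2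

end Differential

end Graph

/-! ## Circles of a smoothed diagram -/

theorem Finset.even_card_of_involution {ι : Type*} (X : Finset ι) (σ : ι → ι)
    (hmem : ∀ x ∈ X, σ x ∈ X) (hne : ∀ x ∈ X, σ x ≠ x) (hσ : ∀ x ∈ X, σ (σ x) = x) :
    Even X.card := by
  have h : ∑ _x ∈ X, (1 : ZMod 2) = 0 :=
    Finset.sum_involution (fun x _ => σ x) (fun _ _ => by decide) (fun x hx _ => hne x hx)
      (fun x hx => hmem x hx) (fun x hx => hσ x hx)
  rw [Finset.sum_const, nsmul_one] at h
  exact (ZMod.natCast_eq_zero_iff_even).1 h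

namespace LinkDiagram

variable {D : LinkDiagram}

theorem smooth_smooth (s : D.KauffmanState) (d : D.End) : D.smooth s (D.smooth s d) = d := by
  obtain ⟨c, k⟩ := d
  unfold smooth
  by_cases h : s c = 1
  · simp only [h, if_true]; fin_cases k <;> rfl
  · simp only [h, if_false]; fin_cases k <;> rfl

theorem smooth_ne (s : D.KauffmanState) (d : D.End) : D.smooth s d ≠ d := by
  obtain ⟨c, k⟩ := d
  unfold smooth
  by_cases h : s c = 1
  · simp only [h, if_true, ne_eq, Prod.mk.injEq, true_and]; fin_cases k <;> decide
  · simp only [h, if_false, ne_eq, Prod.mk.injEq, true_and]; fin_cases k <;> decide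

theorem smooth_congr {s s' : D.KauffmanState} {d : D.End} (h : s d.1 = s' d.1) :
    D.smooth s d = D.smooth s' d := by
  unfold smooth
  rw [h]

theorem circleOf_glue (s : D.KauffmanState) (d : D.End) :
    D.circleOf s (D.glue d) = D.circleOf s d := by
  refine congrArg Sum.inl (Eq.symm (Quot.sound ?_))
  exact Or.inl rfl

theorem circleOf_smooth (s : D.KauffmanState) (d : D.End) :
    D.circleOf s (D.smooth s d) = D.circleOf s d := by
  refine congrArg Sum.inl (Eq.symm (Quot.sound ?_))
  exact Or.inr rfl

theorem circle_cases {s : D.KauffmanState} (C : D.Circle s) :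
    (∃ d, C = D.circleOf s d) ∨ ∃ f, C = D.freeCircle s f := by
  rcases C with C | f
  · obtain ⟨d, rfl⟩ := Quot.exists_rep C
    exact Or.inl ⟨d, rfl⟩
  · exact Or.inr ⟨f, rfl⟩

/-- Lying on one circle is the smallest equivalence relation containing the arcs of the diagram and
of the smoothings. -/
theorem rel_of_circleOf_eq {s : D.KauffmanState} {r : D.End → D.End → Prop} (hr : Equivalence r)
    (hglue : ∀ d, r d (D.glue d)) (hsmooth : ∀ d, r d (D.smooth s d)) {d d' : D.End}
    (h : D.circleOf s d = D.circleOf s d') : r d d' := by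
  replace h := Quot.eqvGen_exact (Sum.inl_injective h)
  induction h with
  | rel x y hxy =>
    rcases hxy with rfl | rfl
    · exact hglue x
    · exact hsmooth x
  | refl x => exact hr.refl x
  | symm x y _ ih => exact hr.symm ih
  | trans x y z _ _ ih₁ ih₂ => exact hr.trans ih₁ ih₂

/-- A circle that passes a crossing only once stays connected when it is cut there. -/
theorem rel_smooth_of_cut {s : D.KauffmanState} {d₀ : D.End}
    (hd₀ : ∀ d, d.1 = d₀.1 → D.circleOf s d = D.circleOf s d₀ → d = d₀ ∨ d = D.smooth s d₀)
    {r : D.End → D.End → Prop} (hr : Equivalence r) (hglue : ∀ d, r d (D.glue d))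
    (hsmooth : ∀ d, d.1 ≠ d₀.1 → r d (D.smooth s d)) : r d₀ (D.smooth s d₀) := by
  classical
  by_contra hcon
  -- `X` is the part of the circle related to `d₀`. If the claim fails, `glue` pairs off `X` and the
  -- smoothing pairs off `X` without `d₀`, so two consecutive numbers would be even.
  let X : Finset D.End := {d | r d₀ d ∧ D.circleOf s d = D.circleOf s d₀}
  have hX : ∀ d, d ∈ X ↔ r d₀ d ∧ D.circleOf s d = D.circleOf s d₀ := by simp [X]
  have h0 : d₀ ∈ X := (hX _).2 ⟨hr.refl _, rfl⟩
  have h1 : Even X.card := X.even_card_of_involution D.glue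
    (fun d hd => (hX _).2 ⟨hr.trans ((hX d).1 hd).1 (hglue d),
      (circleOf_glue s d).trans ((hX d).1 hd).2⟩)
    (fun d _ => D.glue_ne d) (fun d _ => D.glue_glue d)
  have h2 : Even (X.erase d₀).card := by
    refine Finset.even_card_of_involution _ (D.smooth s) (fun d hd => ?_)
      (fun d _ => smooth_ne s d) (fun d _ => smooth_smooth s d)
    obtain ⟨hne, hd⟩ := Finset.mem_erase.1 hd
    obtain ⟨hrd, hcd⟩ := (hX d).1 hd
    by_cases hc : d.1 = d₀.1
    · rcases hd₀ d hc hcd with rfl | rfl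
      · exact absurd rfl hne
      · exact absurd hrd hcon
    · refine Finset.mem_erase.2 ⟨fun h => hc (show (D.smooth s d).1 = _ from congrArg Prod.fst h), (hX _).2 ⟨?_, ?_⟩⟩
      · exact hr.trans hrd (hsmooth d hc)
      · exact (circleOf_smooth s d).trans hcd
  rw [← Finset.card_erase_add_one h0] at h1
  exact (Nat.not_even_iff_odd.2 h2.add_one) h1

theorem circleOf_zero_one {s : D.KauffmanState} {c : Fin D.numCrossings} (h : s c = 1) :
    D.circleOf s (c, 1) = D.circleOf s (c, 0) := by
  have := circleOf_smooth s (c, 0)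
  simpa [smooth, h] using this

theorem circleOf_two_three {s : D.KauffmanState} {c : Fin D.numCrossings} (h : s c = 1) :
    D.circleOf s (c, 3) = D.circleOf s (c, 2) := by
  have := circleOf_smooth s (c, 2)
  simpa [smooth, h] using this

theorem forall_circleOf_ne_iff {s : D.KauffmanState} {c : Fin D.numCrossings} (h : s c = 1)
    (C : D.Circle s) : (∀ k, C ≠ D.circleOf s (c, k)) ↔
      C ≠ D.circleOf s (c, 0) ∧ C ≠ D.circleOf s (c, 2) := by
  rw [Fin.forall_fin_succ, Fin.forall_fin_succ, Fin.forall_fin_succ, Fin.forall_fin_succ]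
  have h1 := circleOf_zero_one h
  have h3 := circleOf_two_three h
  constructor
  · rintro ⟨h0, _, h2, _⟩
    exact ⟨h0, h2⟩
  · rintro ⟨h0, h2⟩
    exact ⟨h0, fun h => h0 (h.trans h1), h2, fun h => h2 (h.trans h3), fun k => k.elim0⟩

/-- Changing a positive marker at a crossing of two different circles merges them. -/
theorem circleOf_eq_of_merge {s s' : D.KauffmanState} {c : Fin D.numCrossings} (hc : s c = 1)
    (hc' : s' c = -1) (hs : ∀ c', c' ≠ c → s' c' = s c')
    (hne : D.circleOf s (c, 0) ≠ D.circleOf s (c, 2)) :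
    (∀ d d', D.circleOf s d = D.circleOf s d' → D.circleOf s' d = D.circleOf s' d') ∧
      D.circleOf s' (c, 0) = D.circleOf s' (c, 2) := by
  have hr : Equivalence fun d d' => D.circleOf s' d = D.circleOf s' d' :=
    ⟨fun _ => rfl, fun h => h.symm, fun h h' => h.trans h'⟩
  have hglue : ∀ d, D.circleOf s' d = D.circleOf s' (D.glue d) :=
    fun d => (circleOf_glue s' d).symm
  have hsmooth : ∀ d : D.End, d.1 ≠ c → D.circleOf s' d = D.circleOf s' (D.smooth s d) := by
    intro d hd
    rw [smooth_congr (hs d.1 hd).symm, circleOf_smooth]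
  have h1 := circleOf_zero_one hc
  have h3 := circleOf_two_three hc
  -- As the two circles at `c` differ, each passes `c` once. What remains of each after cutting is
  -- an arc of `D_{s'}`; the negative smoothing then links the two arcs.
  have h01 : D.circleOf s' (c, 0) = D.circleOf s' (c, 1) := by
    have := rel_smooth_of_cut (s := s) (d₀ := (c, 0)) ?_ hr hglue hsmooth
    · simpa [smooth, hc] using this
    · rintro ⟨c', k⟩ rfl hk
      fin_cases k
      · exact Or.inl rfl
      · right; simp [smooth, hc]
      · exact absurd hk.symm hne
      · exact absurd (hk.symm.trans h3) hne
  have h23 : D.circleOf s' (c, 2) = D.circleOf s' (c, 3) := by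
    have := rel_smooth_of_cut (s := s) (d₀ := (c, 2)) ?_ hr hglue hsmooth
    · simpa [smooth, hc] using this
    · rintro ⟨c', k⟩ rfl hk
      fin_cases k
      · exact absurd hk hne
      · exact absurd (h1.symm.trans hk) hne
      · exact Or.inl rfl
      · right; simp [smooth, hc]
  have h03 : D.circleOf s' (c, 3) = D.circleOf s' (c, 0) := by
    have := circleOf_smooth s' (c, 0)
    simpa [smooth, hc'] using this
  refine ⟨fun d d' h => rel_of_circleOf_eq hr hglue (fun d => ?_) h, ?_⟩
  · by_cases hd : d.1 = c
    · obtain ⟨c', k⟩ := d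
      obtain rfl : c' = c := hd
      unfold smooth
      simp only [hc, if_true]
      fin_cases k
      · exact h01
      · exact h01.symm
      · exact h23
      · exact h23.symm
    · exact hsmooth d hd
  · exact h03.symm.trans h23.symm

/-! ### Circles of a state and components of the spanning subgraph. -/

/-- The Kauffman state whose negative markers are those at the crossings in `s`. -/
def stateOf (D : LinkDiagram) (s : Finset (Fin D.numCrossings)) : D.KauffmanState :=
  fun c => if c ∈ s then -1 else 1

theorem neg_one_ne_one : (-1 : ℤˣ) ≠ 1 := by decide

theorem stateOf_of_mem {s : Finset (Fin D.numCrossings)} {c : Fin D.numCrossings} (h : c ∈ s) :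
    D.stateOf s c = -1 :=
  if_pos h

theorem stateOf_of_notMem {s : Finset (Fin D.numCrossings)} {c : Fin D.numCrossings} (h : c ∉ s) :
    D.stateOf s c = 1 :=
  if_neg h

theorem stateOf_eq_one_iff {s : Finset (Fin D.numCrossings)} {c : Fin D.numCrossings} :
    D.stateOf s c = 1 ↔ c ∉ s := by
  refine ⟨fun h hc => ?_, stateOf_of_notMem⟩
  rw [stateOf_of_mem hc] at h
  exact neg_one_ne_one h

theorem stateOf_eq_neg_one_iff {s : Finset (Fin D.numCrossings)} {c : Fin D.numCrossings} :
    D.stateOf s c = -1 ↔ c ∈ s := by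
  refine ⟨fun h => ?_, stateOf_of_mem⟩
  by_contra hc
  rw [stateOf_of_notMem hc] at h
  exact neg_one_ne_one h.symm

theorem stateOf_injective : Function.Injective D.stateOf := by
  intro s t h
  ext c
  rw [← stateOf_eq_neg_one_iff, h, stateOf_eq_neg_one_iff]

theorem stateOf_surjective : Function.Surjective D.stateOf := by
  intro m
  refine ⟨Finset.univ.filter fun c => m c = -1, ?_⟩
  funext c
  rcases Int.units_eq_one_or (m c) with h | h <;> simp [stateOf, h]

theorem stateOf_insert (s : Finset (Fin D.numCrossings)) (c : Fin D.numCrossings) :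
    D.stateOf (insert c s) = Function.update (D.stateOf s) c (-1) := by
  funext c'
  by_cases h : c' = c
  · subst h; simp [stateOf]
  · simp [stateOf, h]

/-- The vertex of `G_{s₊}(D)` given by the circle through an end. -/
def endVertex (D : LinkDiagram) (d : D.End) : D.positiveGraph.vertexSet :=
  ⟨D.circleOf D.positiveState d, Set.mem_univ _⟩

/-- The vertex of `G_{s₊}(D)` given by a component without crossings. -/
def freeVertex (D : LinkDiagram) (f : Fin D.numFreeCircles) : D.positiveGraph.vertexSet :=
  ⟨D.freeCircle D.positiveState f, Set.mem_univ _⟩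

theorem vertex_cases (v : D.positiveGraph.vertexSet) :
    (∃ d, v = D.endVertex d) ∨ ∃ f, v = D.freeVertex f := by
  obtain ⟨C, _⟩ := v
  rcases circle_cases C with ⟨d, rfl⟩ | ⟨f, rfl⟩
  · exact Or.inl ⟨d, rfl⟩
  · exact Or.inr ⟨f, rfl⟩

theorem isLink_endVertex (c : Fin D.numCrossings) :
    D.positiveGraph.IsLink c (D.endVertex (c, 0)) (D.endVertex (c, 2)) :=
  rfl

theorem isLink_cases {c : Fin D.numCrossings} {u v : D.positiveGraph.vertexSet}
    (h : D.positiveGraph.IsLink c u v) :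
    (u = D.endVertex (c, 0) ∧ v = D.endVertex (c, 2)) ∨
      (u = D.endVertex (c, 2) ∧ v = D.endVertex (c, 0)) := by
  rcases (isLink_endVertex c).eq_and_eq_or_eq_and_eq h with ⟨h1, h2⟩ | ⟨h1, h2⟩
  · exact Or.inl ⟨Subtype.ext h1.symm, Subtype.ext h2.symm⟩
  · exact Or.inr ⟨Subtype.ext h2.symm, Subtype.ext h1.symm⟩

theorem endVertex_eq {d d' : D.End}
    (h : D.circleOf D.positiveState d = D.circleOf D.positiveState d') :
    D.endVertex d = D.endVertex d' :=
  Subtype.ext h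

/-- At a crossing in `s` the negative smoothing connects the two positive arcs, whose circles are
joined by that very edge. At any other crossing the smoothing is that of `s₊`. This makes
`componentOfCircle` well defined. -/
theorem stateComponent_endVertex_smooth (s : Finset (Fin D.numCrossings)) (d : D.End) :
    D.positiveGraph.stateComponent s (D.endVertex (D.smooth (D.stateOf s) d)) =
      D.positiveGraph.stateComponent s (D.endVertex d) := by
  by_cases h : d.1 ∈ s
  · obtain ⟨c, k⟩ := d
    have h02 := Graph.stateComponent_eq_of_isLink h (isLink_endVertex c)
    have h1 : D.endVertex (c, 1) = D.endVertex (c, 0) := endVertex_eq (circleOf_zero_one rfl)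
    have h3 : D.endVertex (c, 3) = D.endVertex (c, 2) := endVertex_eq (circleOf_two_three rfl)
    unfold smooth
    simp only [stateOf_of_mem h, neg_one_ne_one, if_false]
    fin_cases k
    · exact (congrArg _ h3).trans h02.symm
    · exact h02.symm.trans (congrArg _ h1).symm
    · exact (congrArg _ h1).trans h02
    · exact h02.trans (congrArg _ h3).symm
  · rw [smooth_congr (s' := D.positiveState) (stateOf_of_notMem h),
      endVertex_eq (circleOf_smooth _ d)]

/-- The component of `[G_{s₊}(D) : s]` that contains all the circles of `D_{s₊}` met by a
circle of the state with the negative markers in `s`. -/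
def componentOfCircle (s : Finset (Fin D.numCrossings)) :
    D.Circle (D.stateOf s) → D.positiveGraph.StateComponent s :=
  Sum.elim
    (Quot.lift (fun d => D.positiveGraph.stateComponent s (D.endVertex d)) fun d d' h => by
      rcases h with rfl | rfl
      · rw [endVertex_eq (circleOf_glue _ d)]
      · exact (stateComponent_endVertex_smooth s d).symm)
    (fun f => D.positiveGraph.stateComponent s (D.freeVertex f))

theorem componentOfCircle_surjective (s : Finset (Fin D.numCrossings)) :
    Function.Surjective (componentOfCircle s) := by
  intro c
  obtain ⟨v, rfl⟩ := Graph.stateComponent_surjective s c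
  rcases vertex_cases v with ⟨d, rfl⟩ | ⟨f, rfl⟩
  · exact ⟨D.circleOf _ d, rfl⟩
  · exact ⟨D.freeCircle _ f, rfl⟩

theorem endVertex_ne_freeVertex (d : D.End) (f : Fin D.numFreeCircles) :
    D.endVertex d ≠ D.freeVertex f :=
  fun h => Sum.inl_ne_inr (congrArg Subtype.val h)

/-- A component of `D` without crossings is an isolated vertex. -/
theorem eq_freeVertex_of_stateComponent_eq {s : Finset (Fin D.numCrossings)}
    {v : D.positiveGraph.vertexSet} {f : Fin D.numFreeCircles}
    (h : D.positiveGraph.stateComponent s v = D.positiveGraph.stateComponent s (D.freeVertex f)) :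
    v = D.freeVertex f := by
  refine (Graph.rel_of_stateComponent_eq (r := fun u v => u = D.freeVertex f ↔ v = D.freeVertex f)
    ⟨fun _ => Iff.rfl, fun h => h.symm, fun h h' => h.trans h'⟩ ?_ h).2 rfl
  intro c _ u v huv
  rcases isLink_cases huv with ⟨rfl, rfl⟩ | ⟨rfl, rfl⟩ <;> simp [endVertex_ne_freeVertex]

theorem componentOfCircle_empty_injective :
    Function.Injective (componentOfCircle (D := D) ∅) := by
  have hinj : ∀ u v : D.positiveGraph.vertexSet, D.positiveGraph.stateComponent ∅ u =
      D.positiveGraph.stateComponent ∅ v → u = v := fun u v h =>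
    Graph.rel_of_stateComponent_eq (r := fun u v => u = v) eq_equivalence (by simp) h
  intro C C' h
  rcases circle_cases C with ⟨d, rfl⟩ | ⟨f, rfl⟩ <;>
    rcases circle_cases C' with ⟨d', rfl⟩ | ⟨f', rfl⟩ <;>
    exact congrArg Subtype.val (hinj _ _ h)

/-- If the circles of a state are the components of the spanning subgraph, then this remains so
when an edge between different components is added. -/
theorem componentOfCircle_insert_injective {s : Finset (Fin D.numCrossings)}
    {c : Fin D.numCrossings} (hcs : c ∉ s)
    (hs : Function.Injective (componentOfCircle (D := D) s))
    (hne : D.positiveGraph.stateComponent s (D.endVertex (c, 0)) ≠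
      D.positiveGraph.stateComponent s (D.endVertex (c, 2))) :
    Function.Injective (componentOfCircle (D := D) (insert c s)) := by
  obtain ⟨h₁, h₂⟩ := circleOf_eq_of_merge (s := D.stateOf s) (s' := D.stateOf (insert c s))
    (stateOf_of_notMem hcs) (stateOf_of_mem (Finset.mem_insert_self _ _))
    (fun c' hc' => by simp [stateOf, hc']) (fun h => hne (congrArg (componentOfCircle s) h))
  have hm : ∀ {d d' : D.End}, D.positiveGraph.stateComponent s (D.endVertex d) =
      D.positiveGraph.stateComponent s (D.endVertex d') →
      D.circleOf (D.stateOf (insert c s)) d = D.circleOf (D.stateOf (insert c s)) d' :=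
    fun h => h₁ _ _ (hs h)
  intro C C' h
  rcases circle_cases C with ⟨d, rfl⟩ | ⟨f, rfl⟩ <;>
    rcases circle_cases C' with ⟨d', rfl⟩ | ⟨f', rfl⟩
  · rcases (Graph.stateComponent_insert_eq_iff (isLink_endVertex c) _ _).1 h with
      h | ⟨h | h, h' | h'⟩
    · exact hm h
    · exact (hm h).trans (hm h').symm
    · exact (hm h).trans (h₂.trans (hm h').symm)
    · exact (hm h).trans (h₂.symm.trans (hm h').symm)
    · exact (hm h).trans (hm h').symm
  · exact absurd (eq_freeVertex_of_stateComponent_eq h) (endVertex_ne_freeVertex _ _)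
  · exact absurd (eq_freeVertex_of_stateComponent_eq h.symm) (endVertex_ne_freeVertex _ _)
  · exact congrArg Sum.inr (Sum.inr_injective
      (congrArg Subtype.val (eq_freeVertex_of_stateComponent_eq h)))

/-- If there are fewer negative markers than the girth of `G_{s₊}(D)`, then the circles of the
state are the components of the spanning subgraph. -/
theorem componentOfCircle_injective {s : Finset (Fin D.numCrossings)}
    (hs : (s.card : ℕ∞) < D.positiveGraph.girth) :
    Function.Injective (componentOfCircle (D := D) s) := by
  induction s using Finset.induction_on with
  | empty => exact componentOfCircle_empty_injective
  | insert c s hcs ih =>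
    have hle : s.card ≤ (insert c s).card := Finset.card_le_card (Finset.subset_insert _ _)
    exact componentOfCircle_insert_injective hcs (ih (lt_of_le_of_lt (by exact_mod_cast hle) hs))
      (Graph.stateComponent_ne_of_card_lt_girth hcs (isLink_endVertex c) hs)

/-! ## Enhanced states of the graph and of the diagram -/

/-- The sign of a circle that corresponds to the basis element `x ^ k` of `ℤ[x]/(x^2)`. -/
def signOf (k : Fin 2) : ℤˣ := if k = 1 then 1 else -1

theorem signOf_injective : Function.Injective signOf := by decide

theorem signOf_surjective : Function.Surjective signOf := by
  intro u
  rcases Int.units_eq_one_or u with rfl | rfl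
  · exact ⟨1, rfl⟩
  · exact ⟨0, rfl⟩

theorem coe_signOf (k : Fin 2) : (signOf k : ℤ) = 2 * (k : ℕ) - 1 := by
  fin_cases k <;> rfl

/-- The enhanced Kauffman state that corresponds to an enhanced state of `G_{s₊}(D)`. -/
def ofGraphState (S : D.positiveGraph.EnhancedState 2) : D.EnhancedState :=
  ⟨D.stateOf S.edges, fun C => signOf (S.weight (componentOfCircle S.edges C))⟩

theorem ofGraphState_marker (S : D.positiveGraph.EnhancedState 2) :
    (ofGraphState S).marker = D.stateOf S.edges :=
  rfl

theorem ofGraphState_sign_circleOf (S : D.positiveGraph.EnhancedState 2) (d : D.End) :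
    (ofGraphState S).sign (D.circleOf (ofGraphState S).marker d) =
      signOf (S.weight (D.positiveGraph.stateComponent S.edges (D.endVertex d))) :=
  rfl

theorem ofGraphState_sign_freeCircle (S : D.positiveGraph.EnhancedState 2)
    (f : Fin D.numFreeCircles) :
    (ofGraphState S).sign (D.freeCircle (ofGraphState S).marker f) =
      signOf (S.weight (D.positiveGraph.stateComponent S.edges (D.freeVertex f))) :=
  rfl

theorem ofGraphState_injective : Function.Injective (ofGraphState (D := D)) := by
  intro S S' h
  obtain ⟨s, hs, w⟩ := S
  obtain ⟨s', hs', w'⟩ := S'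
  obtain rfl : s = s' := stateOf_injective (congrArg EnhancedState.marker h)
  unfold ofGraphState at h
  rw [EnhancedState.mk.injEq] at h
  congr 1
  funext c
  obtain ⟨C, rfl⟩ := componentOfCircle_surjective s c
  exact signOf_injective (congrFun (eq_of_heq h.2) C)

/-- Injectivity is needed because two circles in the same component could carry different signs. -/
theorem exists_ofGraphState_eq {T : D.EnhancedState} {s : Finset (Fin D.numCrossings)}
    (hT : T.marker = D.stateOf s) (hs : Function.Injective (componentOfCircle (D := D) s)) :
    ∃ S : D.positiveGraph.EnhancedState 2, S.edges = s ∧ ofGraphState S = T := by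
  obtain ⟨m, sg⟩ := T
  obtain rfl : m = D.stateOf s := hT
  let φ := Equiv.ofBijective _ ⟨hs, componentOfCircle_surjective s⟩
  choose g hg using signOf_surjective
  refine ⟨⟨s, fun _ _ => Set.mem_univ _, fun c => g (sg (φ.symm c))⟩, rfl, ?_⟩
  unfold ofGraphState
  congr 1
  funext C
  show signOf (g (sg (φ.symm (φ C)))) = sg C
  rw [hg, Equiv.symm_apply_apply]

theorem sigma_eq {T : D.EnhancedState} {s : Finset (Fin D.numCrossings)}
    (hT : T.marker = D.stateOf s) : T.sigma = D.numCrossings - 2 * s.card := by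
  unfold EnhancedState.sigma
  rw [hT]
  have h : ∀ c, ((D.stateOf s c : ℤˣ) : ℤ) = 1 - 2 * if c ∈ s then 1 else 0 := by
    intro c
    by_cases hc : c ∈ s <;> simp [stateOf, hc]
  simp only [h, Finset.sum_sub_distrib, ← Finset.mul_sum]
  simp

theorem tau_ofGraphState {S : D.positiveGraph.EnhancedState 2}
    (hS : Function.Injective (componentOfCircle (D := D) S.edges)) :
    (ofGraphState S).tau =
      2 * S.degree - Fintype.card (D.positiveGraph.StateComponent S.edges) := by
  have h : (ofGraphState S).tau = ∑ c, (signOf (S.weight c) : ℤ) :=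
    (Equiv.ofBijective _ ⟨hS, componentOfCircle_surjective S.edges⟩).sum_comp
      fun c => (signOf (S.weight c) : ℤ)
  rw [h]
  simp only [coe_signOf, Finset.sum_sub_distrib, ← Finset.mul_sum]
  unfold Graph.EnhancedState.degree
  simp

theorem card_stateComponent_insert {s : Finset (Fin D.numCrossings)} {c : Fin D.numCrossings}
    (hne : D.positiveGraph.stateComponent s (D.endVertex (c, 0)) ≠
      D.positiveGraph.stateComponent s (D.endVertex (c, 2))) :
    Fintype.card (D.positiveGraph.StateComponent s) =
      Fintype.card (D.positiveGraph.StateComponent (insert c s)) + 1 :=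
  Fintype.card_eq_card_add_one_of_merge
    (Graph.stateComponentMap_surjective (Finset.subset_insert c s)) hne
    (Graph.stateComponentMap_insert_eq_iff (isLink_endVertex c))

theorem IsIncident.notMem_and_marker_eq {c : Fin D.numCrossings}
    {S : D.positiveGraph.EnhancedState 2} {T : D.EnhancedState}
    (h : EnhancedState.IsIncident c (ofGraphState S) T) :
    c ∉ S.edges ∧ T.marker = D.stateOf (insert c S.edges) :=
  ⟨stateOf_eq_one_iff.1 h.1, h.2.1.trans (stateOf_insert _ _).symm⟩

/-- The partial multiplications of the two complexes agree for a crossing that joins two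
different components. -/
theorem isIncident_ofGraphState_iff {c : Fin D.numCrossings}
    {S S' : D.positiveGraph.EnhancedState 2}
    (hS : Function.Injective (componentOfCircle (D := D) S.edges))
    (hS' : Function.Injective (componentOfCircle (D := D) S'.edges))
    (hne : c ∉ S.edges → S'.edges = insert c S.edges →
      D.positiveGraph.stateComponent S.edges (D.endVertex (c, 0)) ≠
        D.positiveGraph.stateComponent S.edges (D.endVertex (c, 2)))
    (hdeg : S'.degree = S.degree) :
    EnhancedState.IsIncident c (ofGraphState S) (ofGraphState S') ↔
      Graph.EnhancedState.IsImage c S S' := by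
  by_cases hc : c ∉ S.edges ∧ S'.edges = insert c S.edges
  · obtain ⟨hcS, hedges⟩ := hc
    replace hne := hne hcS hedges
    rw [Graph.EnhancedState.isImage_iff]
    obtain ⟨s, hs, w⟩ := S
    obtain ⟨s', hs', w'⟩ := S'
    obtain rfl : s' = insert c s := hedges
    -- With equal degrees, the loss of one component raises `τ` by exactly one, so the condition on
    -- `τ` is automatic.
    have htau : (ofGraphState ⟨insert c s, hs', w'⟩).tau = (ofGraphState ⟨s, hs, w⟩).tau + 1 := by
      rw [tau_ofGraphState hS, tau_ofGraphState hS', hdeg]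
      have := card_stateComponent_insert hne
      simp only [] at this ⊢
      omega
    have hfib := fiber_sum_iff_of_merge
      (Graph.stateComponentMap_surjective (Finset.subset_insert c s))
      (Graph.stateComponentMap_insert_eq_iff (isLink_endVertex c))
      (fun x => (w x : ℕ)) (fun x => (w' x : ℕ)) hdeg
    refine Iff.trans ?_ (and_congr_right fun _ => and_congr_right fun _ =>
      ((exists_prop_of_true (Finset.subset_insert c s)).trans hfib).symm)
    have hmarker : (ofGraphState ⟨insert c s, hs', w'⟩).marker =
        Function.update (ofGraphState ⟨s, hs, w⟩).marker c (-1) := stateOf_insert s c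
    have hone : (ofGraphState ⟨s, hs, w⟩).marker c = 1 := stateOf_of_notMem hcS
    have hcirc : ∀ d d', D.circleOf (D.stateOf s) d = D.circleOf (D.stateOf s) d' ↔
        D.positiveGraph.stateComponent s (D.endVertex d) =
          D.positiveGraph.stateComponent s (D.endVertex d') :=
      fun d d' => ⟨fun h => congrArg (componentOfCircle s) h, fun h => hS h⟩
    constructor
    · rintro ⟨-, -, hend, hfree, -⟩
      refine ⟨hcS, rfl, fun x hxa hxb => ?_⟩
      obtain ⟨v, rfl⟩ := Graph.stateComponent_surjective s x
      rcases vertex_cases v with ⟨d, rfl⟩ | ⟨f, rfl⟩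
      · exact congrArg _ (signOf_injective (hend d ((forall_circleOf_ne_iff hone _).2
          ⟨fun h => hxa ((hcirc _ _).1 h), fun h => hxb ((hcirc _ _).1 h)⟩)))
      · exact congrArg _ (signOf_injective (hfree f))
    · rintro ⟨-, -, h⟩
      refine ⟨hone, hmarker, fun d hd => ?_, fun f => ?_, htau⟩
      · obtain ⟨h0, h2⟩ := (forall_circleOf_ne_iff hone _).1 hd
        exact congrArg signOf (Fin.ext (h _ (fun h => h0 ((hcirc _ _).2 h))
          (fun h => h2 ((hcirc _ _).2 h))))
      · exact congrArg signOf (Fin.ext (h _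
          (fun h => endVertex_ne_freeVertex _ _ (eq_freeVertex_of_stateComponent_eq h.symm))
          (fun h => endVertex_ne_freeVertex _ _ (eq_freeVertex_of_stateComponent_eq h.symm))))
  · refine iff_of_false (fun h => hc ?_) (fun h => hc ⟨h.1, h.2.1⟩)
    obtain ⟨h1, h2⟩ := IsIncident.notMem_and_marker_eq h
    exact ⟨h1, stateOf_injective h2⟩

theorem tau_ofGraphState_of_card_lt_girth {S : D.positiveGraph.EnhancedState 2}
    (hS : (S.edges.card : ℕ∞) < D.positiveGraph.girth) :
    (ofGraphState S).tau = 2 * S.degree - D.positiveGraph.vertexSet.ncard + S.edges.card := by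
  rw [tau_ofGraphState (componentOfCircle_injective hS)]
  have := Graph.card_stateComponent_add_card S.edges_subset hS
  omega

/-- The faces of the cube of smoothings commute, whether or not the two crossings close up a
cycle. -/
theorem exists_isIncident_comm {e e' : Fin D.numCrossings}
    {S S' : D.positiveGraph.EnhancedState 2} {T : D.EnhancedState}
    (hS : ((S.edges.card + 1 : ℕ) : ℕ∞) < D.positiveGraph.girth)
    (h : Graph.EnhancedState.IsImage e S S')
    (h' : EnhancedState.IsIncident e' (ofGraphState S') T) :
    ∃ S₁, Graph.EnhancedState.IsImage e' S S₁ ∧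
      EnhancedState.IsIncident e (ofGraphState S₁) T := by
  have heE : e' ∈ D.positiveGraph.edgeSet := Set.mem_univ _
  obtain ⟨heS', hT⟩ := IsIncident.notMem_and_marker_eq h'
  obtain ⟨he, hS'⟩ : e ∉ S.edges ∧ S'.edges = insert e S.edges := ⟨h.1, h.2.1⟩
  obtain ⟨hee', he'⟩ : e' ≠ e ∧ e' ∉ S.edges := by
    rwa [hS', Finset.mem_insert, not_or] at heS'
  have hgirth : ∀ {f}, f ∉ S.edges → ((insert f S.edges).card : ℕ∞) < D.positiveGraph.girth := by
    intro f hf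
    rwa [Finset.card_insert_of_notMem hf]
  have hne := Graph.stateComponent_ne_of_card_lt_girth he (isLink_endVertex e) (hgirth he)
  have hne' := Graph.stateComponent_ne_of_card_lt_girth he' (isLink_endVertex e') (hgirth he')
  have hinj' : Function.Injective (componentOfCircle (D := D) S'.edges) := by
    rw [hS']
    exact componentOfCircle_injective (hgirth he)
  have hiff := Graph.stateComponent_insert_eq_iff (s := S.edges) (isLink_endVertex e)
  have hiff' := Graph.stateComponent_insert_eq_iff (s := S.edges) (isLink_endVertex e')
  -- If `e'` closes a cycle, a circle may split and `T` need not come from a graph state. But then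
  -- `e` and `e'` join the same two components of `[G : s]`, so adding either one gives the same
  -- components and the same weights.
  by_cases hcyc : D.positiveGraph.stateComponent S'.edges (D.endVertex (e', 0)) =
      D.positiveGraph.stateComponent S'.edges (D.endVertex (e', 2))
  · rw [hS'] at hcyc
    have hab := ((hiff _ _).1 hcyc).resolve_left hne'
    have hsame : ∀ x y, D.positiveGraph.stateComponent (insert e' S.edges) x =
        D.positiveGraph.stateComponent (insert e' S.edges) y ↔
        D.positiveGraph.stateComponent (insert e S.edges) x =
        D.positiveGraph.stateComponent (insert e S.edges) y := by
      intro x y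
      rw [hiff, hiff']
      rcases hab with ⟨h1 | h1, h2 | h2⟩
      · exact absurd (h1.trans h2.symm) hne'
      · rw [h1, h2]
      · rw [h1, h2]
        simp only [or_comm]
      · exact absurd (h1.trans h2.symm) hne'
    obtain ⟨_, _, hsub, hw⟩ := Graph.EnhancedState.isImage_iff.1 h
    have hpush : ∀ v, Graph.pushWeight (Finset.subset_insert e' S.edges)
        (fun c => (S.weight c : ℕ)) (D.positiveGraph.stateComponent _ v) =
        (S'.weight (D.positiveGraph.stateComponent S'.edges v) : ℕ) := by
      intro v
      rw [hw]
      unfold Graph.pushWeight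
      refine Finset.sum_congr ?_ fun _ _ => rfl
      ext x
      obtain ⟨u, rfl⟩ := Graph.stateComponent_surjective S.edges x
      simp only [Finset.mem_filter, Finset.mem_univ, true_and,
        Graph.stateComponentMap_stateComponent, hsame]
      rw [hS']
    obtain ⟨S₁, hS₁, h₁⟩ := Graph.EnhancedState.exists_isImage he' heE (fun c => by
      obtain ⟨v, rfl⟩ := Graph.stateComponent_surjective _ c
      rw [hpush]
      exact (S'.weight _).2)
    refine ⟨S₁, h₁, ?_⟩
    obtain ⟨_, _, hsub₁, hw₁⟩ := Graph.EnhancedState.isImage_iff.1 h₁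
    have hweight : ∀ v, S₁.weight (D.positiveGraph.stateComponent S₁.edges v) =
        S'.weight (D.positiveGraph.stateComponent S'.edges v) := by
      intro v
      refine Fin.ext ((hw₁ _).trans ((hpush v).symm.trans ?_).symm)
      have hcast : ∀ t, t = insert e' S.edges → ∀ ht : S.edges ⊆ t,
          Graph.pushWeight (Finset.subset_insert e' S.edges) (fun c => (S.weight c : ℕ))
            (D.positiveGraph.stateComponent _ v) =
          Graph.pushWeight ht (fun c => (S.weight c : ℕ)) (D.positiveGraph.stateComponent t v) := by
        rintro _ rfl _
        rfl
      exact hcast _ hS₁ _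
    have hone : (ofGraphState S₁).marker e = 1 := by
      refine stateOf_of_notMem ?_
      rw [hS₁, Finset.mem_insert, not_or]
      exact ⟨hee'.symm, he⟩
    have hone' : (ofGraphState S').marker e' = 1 := h'.1
    have hends : ∀ k : Fin 4, k = 0 ∨ k = 2 →
        D.positiveGraph.stateComponent S'.edges (D.endVertex (e', k)) =
          D.positiveGraph.stateComponent S'.edges (D.endVertex (e, 0)) := by
      intro k hk
      rw [hS', hiff]
      right
      refine ⟨?_, Or.inl rfl⟩
      rcases hk with rfl | rfl
      · exact hab.1
      · exact hab.2
    refine ⟨hone, ?_, fun d hd => ?_, fun f => ?_, ?_⟩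
    · rw [hT, ofGraphState_marker, ← stateOf_insert, hS', hS₁, Finset.insert_comm]
    -- In either order the second crossing meets only the merged component. Hence a circle of `S₁`
    -- away from `e` corresponds to a circle of `S'` away from `e'`.
    · have hd0 := ((forall_circleOf_ne_iff hone _).1 hd).1
      have hdS' : D.positiveGraph.stateComponent S'.edges (D.endVertex d) ≠
          D.positiveGraph.stateComponent S'.edges (D.endVertex (e, 0)) := by
        rw [hS', Ne, ← hsame, ← hS₁]
        intro hd
        refine hd0 (componentOfCircle_injective (s := S₁.edges) ?_ hd)
        rw [hS₁]
        exact hgirth he'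
      rw [ofGraphState_sign_circleOf, hweight, ← ofGraphState_sign_circleOf]
      refine h'.2.2.1 d ((forall_circleOf_ne_iff hone' _).2 ⟨fun hd => ?_, fun hd => ?_⟩)
      · exact hdS' ((congrArg (componentOfCircle S'.edges) hd).trans (hends 0 (Or.inl rfl)))
      · exact hdS' ((congrArg (componentOfCircle S'.edges) hd).trans (hends 2 (Or.inr rfl)))
    · rw [ofGraphState_sign_freeCircle, hweight, ← ofGraphState_sign_freeCircle]
      exact h'.2.2.2.1 f
    · rw [h'.2.2.2.2, tau_ofGraphState_of_card_lt_girth (hS' ▸ hgirth he),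
        tau_ofGraphState_of_card_lt_girth (hS₁ ▸ hgirth he'), h.degree_eq, h₁.degree_eq, hS', hS₁,
        Finset.card_insert_of_notMem he, Finset.card_insert_of_notMem he']
  -- Here `T` comes from a graph state, and the claim reduces to the commuting multiplications of
  -- the chromatic complex.
  · have hinj'' := componentOfCircle_insert_injective heS' hinj' hcyc
    obtain ⟨S'', hS'', rfl⟩ := exists_ofGraphState_eq hT hinj''
    rw [← hS''] at hinj''
    have hdeg : S''.degree = S'.degree := by
      have ht := h'.2.2.2.2
      rw [tau_ofGraphState hinj', tau_ofGraphState hinj''] at ht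
      have := card_stateComponent_insert hcyc
      rw [← hS''] at this
      omega
    have himage := (isIncident_ofGraphState_iff hinj' hinj'' (fun _ _ => hcyc) hdeg).1 h'
    obtain ⟨S₁, h₁, h₁'⟩ := h.exists_comm himage
    have hS₁ : S₁.edges = insert e' S.edges := h₁.2.1
    refine ⟨S₁, h₁, (isIncident_ofGraphState_iff ?_ hinj'' (fun _ _ => ?_) h₁'.degree_eq).2 h₁'⟩
    · rw [hS₁]
      exact componentOfCircle_injective (hgirth he')
    · rw [hS₁]
      -- If `e` closed a cycle after `e'`, the two edges would join the same components, and `e'`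
      -- would close one after `e`.
      intro h02
      have hab := ((hiff' _ _).1 h02).resolve_left hne
      apply hcyc
      rw [hS', hiff]
      right
      rcases hab with ⟨h1 | h1, h2 | h2⟩
      · exact absurd (h1.trans h2.symm) hne
      · exact ⟨Or.inl h1.symm, Or.inr h2.symm⟩
      · exact ⟨Or.inr h2.symm, Or.inl h1.symm⟩
      · exact absurd (h1.trans h2.symm) hne

/-! ## The comparison of the two complexes -/

theorem ncard_edgeSet_positiveGraph : D.positiveGraph.edgeSet.ncard = D.numCrossings := by
  show (Set.univ : Set (Fin D.numCrossings)).ncard = _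
  rw [Set.ncard_univ, Nat.card_fin]

/-- The bijection of the bases of the two complexes in a degree below the girth. -/
theorem exists_basisEquiv {i j a b : ℤ}
    (hi : ∀ s : Finset (Fin D.numCrossings), (s.card : ℤ) = i →
      (s.card : ℕ∞) < D.positiveGraph.girth)
    (ha : a = D.numCrossings - 2 * i)
    (hb : b = D.numCrossings - 2 * D.positiveGraph.vertexSet.ncard + 4 * j) :
    ∃ φ : D.positiveGraph.BasisState 2 i j ≃ D.BasisState a b,
      ∀ S, (φ S).1 = ofGraphState S.1 := by
  have hmem : ∀ S : D.positiveGraph.EnhancedState 2, (S.edges.card : ℤ) = i →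
      ((ofGraphState S).sigma = a ∧ (ofGraphState S).sigma + 2 * (ofGraphState S).tau = b ↔
        (S.degree : ℤ) = j) := by
    intro S hS
    rw [sigma_eq (ofGraphState_marker S), tau_ofGraphState_of_card_lt_girth (hi _ hS)]
    omega
  refine ⟨Equiv.ofBijective (fun S => ⟨ofGraphState S.1, (hmem S.1 S.2.1).2 S.2.2⟩) ⟨?_, ?_⟩,
    fun S => rfl⟩
  · intro S S' h
    exact Subtype.ext (ofGraphState_injective (congrArg Subtype.val h))
  · rintro ⟨T, hT⟩
    obtain ⟨s, hs⟩ := stateOf_surjective T.marker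
    have hcard : (s.card : ℤ) = i := by
      have := hT.1
      rw [sigma_eq hs.symm] at this
      omega
    obtain ⟨S, rfl, rfl⟩ := exists_ofGraphState_eq hs.symm (componentOfCircle_injective (hi _ hcard))
    exact ⟨⟨S, hcard, (hmem S hcard).1 hT⟩, rfl⟩

theorem filter_stateOf (s : Finset (Fin D.numCrossings)) (c : Fin D.numCrossings) :
    (Finset.univ.filter fun c' => c' < c ∧ D.stateOf s c' = -1) = s.filter (· < c) := by
  ext c'
  simp [stateOf_eq_neg_one_iff, and_comm]

theorem isIncident_basis_iff {i j : ℤ}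
    (hi : ∀ s : Finset (Fin D.numCrossings), (s.card : ℤ) = i + 1 →
      (s.card : ℕ∞) < D.positiveGraph.girth)
    (S : D.positiveGraph.BasisState 2 i j) (S' : D.positiveGraph.BasisState 2 (i + 1) j)
    (c : Fin D.numCrossings) :
    EnhancedState.IsIncident c (ofGraphState S.1) (ofGraphState S'.1) ↔
      Graph.EnhancedState.IsImage c S.1 S'.1 := by
  have hS' := hi _ S'.2.1
  have hS : (S.1.edges.card : ℕ∞) < D.positiveGraph.girth := by
    refine lt_of_le_of_lt ?_ hS'
    have h1 := S.2.1
    have h2 := S'.2.1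
    exact_mod_cast (by omega : S.1.edges.card ≤ S'.1.edges.card)
  refine isIncident_ofGraphState_iff (componentOfCircle_injective hS)
    (componentOfCircle_injective hS') (fun hc hSS' => ?_) (by exact_mod_cast S'.2.2.trans S.2.2.symm)
  exact Graph.stateComponent_ne_of_card_lt_girth hc (isLink_endVertex c) (hSS' ▸ hS')

theorem incidence_basis_eq {i j : ℤ}
    (hi : ∀ s : Finset (Fin D.numCrossings), (s.card : ℤ) = i + 1 →
      (s.card : ℕ∞) < D.positiveGraph.girth)
    (S : D.positiveGraph.BasisState 2 i j) (S' : D.positiveGraph.BasisState 2 (i + 1) j) :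
    (ofGraphState S.1).incidence (ofGraphState S'.1) = S.1.incidence S'.1 := by
  unfold EnhancedState.incidence Graph.EnhancedState.incidence
  refine Finset.sum_congr rfl fun c _ => ?_
  rw [ofGraphState_marker, filter_stateOf]
  by_cases h : Graph.EnhancedState.IsImage c S.1 S'.1
  · rw [if_pos ((isIncident_basis_iff hi S S' c).2 h), if_pos h]
  · rw [if_neg (mt (isIncident_basis_iff hi S S' c).1 h), if_neg h]

/-- The Khovanov boundary maps agree with the chromatic differentials below the girth. -/
theorem exists_basisEquiv_khovanovD {i j a a' b : ℤ}
    (hi : ∀ s : Finset (Fin D.numCrossings), (s.card : ℤ) = i + 1 →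
      (s.card : ℕ∞) < D.positiveGraph.girth)
    (φ : D.positiveGraph.BasisState 2 i j ≃ D.BasisState a b)
    (hφ : ∀ S, (φ S).1 = ofGraphState S.1)
    (φ' : D.positiveGraph.BasisState 2 (i + 1) j ≃ D.BasisState a' b)
    (hφ' : ∀ S, (φ' S).1 = ofGraphState S.1) (x : D.positiveGraph.BasisState 2 i j → ℤ) :
    LinearEquiv.funCongrLeft ℤ ℤ φ'.symm (D.positiveGraph.chromaticD 2 i (i + 1) j x) =
      D.khovanovD a a' b (LinearEquiv.funCongrLeft ℤ ℤ φ.symm x) := by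
  refine Matrix.funCongrLeft_mulVecLin _ _ φ φ' (fun S' S => ?_) x
  rw [Matrix.of_apply, Matrix.of_apply, hφ, hφ']
  exact incidence_basis_eq hi S S'

/-- The first two groups are replaced by the chromatic ones, so only the last one consists of
arbitrary Kauffman states. Nothing is assumed about the girth in cochain degree `i + 2`. -/
theorem khovanovD_khovanovD {i j a₀ a₁ a₂ b : ℤ}
    (hi : ∀ s : Finset (Fin D.numCrossings), (s.card : ℤ) = i + 1 →
      (s.card : ℕ∞) < D.positiveGraph.girth)
    (φ : D.positiveGraph.BasisState 2 i j ≃ D.BasisState a₀ b)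
    (hφ : ∀ S, (φ S).1 = ofGraphState S.1)
    (φ' : D.positiveGraph.BasisState 2 (i + 1) j ≃ D.BasisState a₁ b)
    (hφ' : ∀ S, (φ' S).1 = ofGraphState S.1) (x : D.BasisState a₀ b → ℤ) :
    D.khovanovD a₁ a₂ b (D.khovanovD a₀ a₁ b x) = 0 := by
  classical
  unfold khovanovD
  rw [Matrix.mulVecLin_apply, Matrix.mulVecLin_apply, Matrix.mulVec_mulVec]
  refine (congrArg (Matrix.mulVec · x) ?_).trans (Matrix.zero_mulVec x)
  ext T S
  obtain ⟨S, rfl⟩ := φ.surjective S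
  rw [Matrix.mul_apply, ← φ'.sum_comp]
  refine Eq.trans (Finset.sum_congr rfl fun S' _ => ?_) (sum_signed_incidence_mul_eq_zero
    (fun S : D.positiveGraph.BasisState 2 i j => S.1.edges)
    (fun S' : D.positiveGraph.BasisState 2 (i + 1) j => S'.1.edges)
    (fun e S S' => Graph.EnhancedState.IsImage e S.1 S'.1)
    (fun e S' (T : D.BasisState a₂ b) => EnhancedState.IsIncident e (ofGraphState S'.1) T.1)
    (fun e S S' h => ⟨h.1, h.2.1⟩) (fun e S' T h => (IsIncident.notMem_and_marker_eq h).1)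
    (fun e S S₁ S₂ h₁ h₂ => Subtype.ext (h₁.eq h₂)) ?_ S T)
  · rw [Matrix.of_apply, Matrix.of_apply, hφ, hφ', incidence_basis_eq hi]
    unfold EnhancedState.incidence Graph.EnhancedState.incidence
    congr 1
    refine Finset.sum_congr rfl fun c _ => ?_
    rw [ofGraphState_marker, filter_stateOf]
  · rintro e e' S T ⟨S', h, h'⟩
    have hcard : ∀ {f S₁}, Graph.EnhancedState.IsImage f S.1 S₁ →
        (S₁.edges.card : ℤ) = i + 1 := by
      intro f S₁ h₁
      rw [h₁.2.1, Finset.card_insert_of_notMem h₁.1]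
      have := S.2.1
      push_cast
      omega
    have hS : ((S.1.edges.card + 1 : ℕ) : ℕ∞) < D.positiveGraph.girth := by
      rw [← Finset.card_insert_of_notMem h.1, ← h.2.1]
      exact hi _ (hcard h)
    obtain ⟨S₁, h₁, h₁'⟩ := exists_isIncident_comm hS h h'
    exact ⟨⟨S₁, hcard h₁, by rw [h₁.degree_eq]; exact S.2.2⟩, h₁, h₁'⟩

end LinkDiagram

/-! ### Assembly of the two cases. -/

theorem theorem3p6 (D : LinkDiagram) (i : ℕ) (j a b : ℤ)
    (ha : a = (D.positiveGraph.edgeSet.ncard : ℤ) - 2 * i)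
    (hb : b = (D.positiveGraph.edgeSet.ncard : ℤ) - 2 * D.positiveGraph.vertexSet.ncard + 4 * j) :
    ((i : ℕ∞) + 1 < D.positiveGraph.girth →
      Nonempty (D.positiveGraph.ChromaticCohomology 2 i j ≃+ D.KhovanovHomology a b)) ∧
    ((i : ℕ∞) + 1 = D.positiveGraph.girth →
      Nonempty (Submodule.torsion ℤ (D.positiveGraph.ChromaticCohomology 2 i j) ≃+
        Submodule.torsion ℤ (D.KhovanovHomology a b))) := by
  rw [LinkDiagram.ncard_edgeSet_positiveGraph] at ha hb
  have hcard : ∀ k : ℕ, (k : ℕ∞) < D.positiveGraph.girth → ∀ l : ℤ, l ≤ k →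
      ∀ s : Finset (Fin D.numCrossings), (s.card : ℤ) = l →
        (s.card : ℕ∞) < D.positiveGraph.girth := by
    intro k hk l hl s hs
    refine lt_of_le_of_lt ?_ hk
    exact_mod_cast (by omega : s.card ≤ k)
  have hlow : (i : ℕ∞) < D.positiveGraph.girth →
      ∃ (φ₀ : D.positiveGraph.BasisState 2 (i - 1) j ≃ D.BasisState (a + 2) b)
        (φ₁ : D.positiveGraph.BasisState 2 i j ≃ D.BasisState a b),
        (∀ S, (φ₁ S).1 = LinkDiagram.ofGraphState S.1) ∧
        (∀ x, LinearEquiv.funCongrLeft ℤ ℤ φ₁.symm (D.positiveGraph.chromaticD 2 (i - 1) i j x) =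
          D.khovanovD (a + 2) a b (LinearEquiv.funCongrLeft ℤ ℤ φ₀.symm x)) ∧
        ∀ x, D.khovanovD a (a - 2) b (D.khovanovD (a + 2) a b x) = 0 := by
    intro hi
    have hlt := hcard i hi
    -- For `i = 0` this is the cochain degree `-1`, where both bases are empty.
    obtain ⟨φ₀, hφ₀⟩ := LinkDiagram.exists_basisEquiv (j := j) (a := a + 2) (b := b)
      (hlt (i - 1) (by omega)) (by omega) hb
    obtain ⟨φ₁, hφ₁⟩ := LinkDiagram.exists_basisEquiv (j := j) (a := a) (b := b)
      (hlt i le_rfl) (by omega) hb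
    refine ⟨φ₀, φ₁, hφ₁, ?_⟩
    have hi1 := hlt (i - 1 + 1) (by omega)
    -- The comparison lemmas go from degree `k` to `k + 1`, so `i` is rewritten as `k + 1` inside
    -- the types.
    generalize hk : (i : ℤ) - 1 = k at *
    obtain hk' : (i : ℤ) = k + 1 := by omega
    generalize (i : ℤ) = i' at *
    subst hk'
    exact ⟨LinkDiagram.exists_basisEquiv_khovanovD hi1 φ₀ hφ₀ φ₁ hφ₁,
      LinkDiagram.khovanovD_khovanovD hi1 φ₀ hφ₀ φ₁ hφ₁⟩
  constructor
  · intro hi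
    have hi' : ((i + 1 : ℕ) : ℕ∞) < D.positiveGraph.girth := by exact_mod_cast hi
    obtain ⟨φ₀, φ₁, hφ₁, hcomm, -⟩ := hlow
      (lt_of_le_of_lt (by exact_mod_cast Nat.le_succ i) hi')
    have hi1 := hcard (i + 1) hi' (i + 1) (by simp)
    obtain ⟨φ₂, hφ₂⟩ := LinkDiagram.exists_basisEquiv (j := j) (a := a - 2) (b := b)
      hi1 (by omega) hb
    exact HomologyAt.nonempty_addEquiv (LinearEquiv.funCongrLeft ℤ ℤ φ₀.symm)
      (LinearEquiv.funCongrLeft ℤ ℤ φ₁.symm) (LinearEquiv.funCongrLeft ℤ ℤ φ₂.symm) hcomm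
      (LinkDiagram.exists_basisEquiv_khovanovD hi1 φ₁ hφ₁ φ₂ hφ₂)
  · intro hi
    -- In degree `i + 1 = ℓ` the bases are not compared; the vanishing composites replace that
    -- comparison.
    obtain ⟨φ₀, φ₁, -, hcomm, hdd⟩ := hlow (by
      rw [← hi]
      exact_mod_cast Nat.lt_succ_self i)
    exact HomologyAt.nonempty_torsion_addEquiv_of_equiv
      (Graph.chromaticD_chromaticD _ _) hdd (LinearEquiv.funCongrLeft ℤ ℤ φ₀.symm)
      (LinearEquiv.funCongrLeft ℤ ℤ φ₁.symm) hcomm
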